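/- Let a system with finite-dimensional Hilbert space and Hamiltonian $H_S=\sum_i\epsilon_i|\epsilon_i\rangle\langle\epsilon_i|$ be coupled to a weight with Hilbert space $L^2(\mathbb R)$ (energy representation) and Hamiltonian $(H_W\psi)(E)=E\psi(E)$; let $\Delta_W=-i\,d/dE$ be the time operator, so that $(e^{-i\Delta_W\epsilon}\psi)(E)=\psi(E-\epsilon)$. Let $V_S$ be a unitary on the system, $S=e^{-iH_S\otimes\Delta_W}$, $U=S^\dagger(V_S\otimes 1)S$, and $W_S=H_S-V_S^\dagger H_SV_S$. Let $\rho_S$, $\rho_W$ be density operators with $\langle H_W^2\rangle_{\rho_W}<\infty$, and put $\rho=\rho_S\otimes\rho_W$, $\sigma=S\rho S^\dagger$, $\sigma_S=\operatorname{Tr}_W\sigma$. With $\langle A\rangle_\tau=\operatorname{Tr}[A\tau]$, $\mathrm{Cov}_\tau[A,B]=\tfrac12\langle AB+BA\rangle_\tau-\langle A\rangle_\tau\langle B\rangle_\tau$ and $\mathrm{Var}_\tau[A]=\mathrm{Cov}_\tau[A,A]$, define $$\Delta\sigma_W^2=\mathrm{Var}_\rho[U^\dagger H_WU]-\mathrm{Var}_\rho[H_W],\qquad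 F=\mathrm{Cov}_\sigma[H_S-H_W,\;V_S^\dagger H_SV_S].$$ With the Wigner function $W(E,t)=\frac1{2\pi}\int d\omega\,e^{i\omega t}\langle E-\tfrac\omega2|\rho_W|E+\tfrac\omega2\rangle$ let $$\xi_S(s)=\frac{\int dt\int dE\,e^{iEs}\,W(E,t)\,e^{-iH_St}\rho_Se^{iH_St}}{\operatorname{Tr}[e^{iH_Ws}\rho_W]}$$ for all real $s$ at which the denominator does not vanish. The state $\rho_S\otimes\rho_W$ is called semi-classical if $\xi_S(s)=\sigma_S$ for all these $s$. Then the second moments of $H_W$ and of $U^\dagger H_WU$ in $\rho$, and of $H_W$ in $\sigma$, are finite. If $\rho_S\otimes\rho_W$ is semi-classical, then $F=0$ and $$\Delta\sigma_W^2=\mathrm{Var}_{\sigma_S}[W_S]\ge 0 .$$ In particular this applies if $\rho_W=|\psi\rangle\langle\psi|$ is a Gaussian wave packet, $\psi(E)=(2\pi\varsigma^2)^{-1/4}e^{-(E-\mu)^2/(4\varsigma^2)+i\nu E}$ with $\mu,\nu\in\mathbb R$ and $\varsigma>0$, or if the system state is incoherent, $[\rho_S,H_S]=0$: in both cases $\rho_S\otimes\rho_W$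 is semi-classical. -/

import Mathlib

open MeasureTheory Complex
open scoped ENNReal ComplexOrder InnerProductSpace

noncomputable section

namespace QuantumWeight

/-! ### Traces, states, means and covariances on a Hilbert space -/

section Hilbert

variable (H : Type*) [NormedAddCommGroup H] [InnerProductSpace ℂ H] [CompleteSpace H]

/-- Index set of a fixed Hilbert basis of `H`. -/
def basisIndex : Set H := (exists_hilbertBasis ℂ H).choose

/-- A fixed Hilbert basis of `H`. -/
def onb : HilbertBasis (basisIndex H) ℂ H := (exists_hilbertBasis ℂ H).choose_spec.choose

variable {H}

/-- `Tr A = ∑ₖ ⟨bₖ, A bₖ⟩`; it is only used for trace-class operators, for which it does not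
depend on the Hilbert basis. -/
def trace (A : H →L[ℂ] H) : ℂ := ∑' k, ⟪onb H k, A (onb H k)⟫_ℂ

/-- A density operator: a positive operator whose trace is `1`. (For a positive operator the
diagonal sum converges in one Hilbert basis iff it converges in all, with the same value.) -/
structure IsDensityOperator (ρ : H →L[ℂ] H) : Prop where
  isPositive : ρ.IsPositive
  hasSum_one : HasSum (fun k => ⟪onb H k, ρ (onb H k)⟫_ℂ) 1

open Classical in
/-- The value `A x` of a partially defined operator, extended by `0` outside the domain. -/
def app (A : H →ₗ.[ℂ] H) (x : H) : H := if h : x ∈ A.domain then A ⟨x, h⟩ else 0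

/-- `⟨A²⟩_ρ = Tr[√ρ A A √ρ] = ∑ₖ ‖A √ρ bₖ‖²` is finite (and `A √ρ` is defined). -/
structure HasFiniteSecondMoment (A : H →ₗ.[ℂ] H) (ρ : H →L[ℂ] H) : Prop where
  mem_domain : ∀ k, CFC.sqrt ρ (onb H k) ∈ A.domain
  summable : Summable fun k => ‖app A (CFC.sqrt ρ (onb H k))‖ ^ 2

/-- The mean `⟨A⟩_ρ = Tr[A ρ] = Tr[√ρ A √ρ]` of a symmetric operator `A` in the state `ρ`
(the terms of the sum are real for symmetric `A`). -/
def mean (ρ : H →L[ℂ] H) (A : H →ₗ.[ℂ] H) : ℝ :=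
  ∑' k, (⟪CFC.sqrt ρ (onb H k), app A (CFC.sqrt ρ (onb H k))⟫_ℂ).re

/-- The symmetrized covariance `½⟨AB + BA⟩_ρ - ⟨A⟩_ρ ⟨B⟩_ρ` of symmetric operators, where
`½⟨AB + BA⟩_ρ = Re Tr[√ρ A B √ρ] = ∑ₖ Re ⟨A √ρ bₖ, B √ρ bₖ⟩`. -/
def cov (ρ : H →L[ℂ] H) (A B : H →ₗ.[ℂ] H) : ℝ :=
  (∑' k, (⟪app A (CFC.sqrt ρ (onb H k)), app B (CFC.sqrt ρ (onb H k))⟫_ℂ).re)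
    - mean ρ A * mean ρ B

/-- The variance `Var_ρ[A] = Cov_ρ[A, A]`. -/
def var (ρ : H →L[ℂ] H) (A : H →ₗ.[ℂ] H) : ℝ := cov ρ A A

/-- A bounded operator as a partially defined operator with full domain. -/
def ofBounded (A : H →L[ℂ] H) : H →ₗ.[ℂ] H := (A : H →ₗ[ℂ] H).toPMap ⊤

/-- `U† A U` with its natural domain `{x | U x ∈ dom A}`, for a bounded `U`. -/
def conjBy (U : H →L[ℂ] H) (A : H →ₗ.[ℂ] H) : H →ₗ.[ℂ] H where
  domain := A.domain.comap (U : H →ₗ[ℂ] H)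
  toFun := (ContinuousLinearMap.adjoint U : H →ₗ[ℂ] H) ∘ₗ A.toFun ∘ₗ
    ((U : H →ₗ[ℂ] H).restrict (p := A.domain.comap (U : H →ₗ[ℂ] H)) (q := A.domain)
      fun _ h => h)

end Hilbert

/-! ### The weight: `L²(ℝ)` in the energy representation -/

/-- The Hilbert space of the weight, `ψ(E) = ⟨E|ψ⟩`. -/
abbrev Weight : Type := Lp ℂ 2 (volume : Measure ℝ)

/-- The Hamiltonian `H_W = ∫ dE E |E⟩⟨E|`: multiplication by `E` on its maximal domain. -/
def weightHamiltonian : Weight →ₗ.[ℂ] Weight where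
  domain :=
    { carrier := {ψ | MemLp (fun E : ℝ => (E : ℂ) * ψ E) 2 volume}
      add_mem' := by
        intro a b ha hb
        refine (MemLp.add ha hb).ae_eq ?_
        filter_upwards [Lp.coeFn_add a b] with E hE
        simp only [Pi.add_apply, hE, mul_add]
      zero_mem' := by
        refine (MemLp.zero' (ε := ℂ)).ae_eq ?_
        filter_upwards [Lp.coeFn_zero ℂ 2 (volume : Measure ℝ)] with E _
        simp
      smul_mem' := by
        intro c a ha
        refine (MemLp.const_smul ha c).ae_eq ?_
        filter_upwards [Lp.coeFn_smul c a] with E hE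
        simp only [Pi.smul_apply, hE, smul_eq_mul]
        ring }
  toFun :=
    { toFun := fun ψ => MemLp.toLp (fun E : ℝ => (E : ℂ) * (ψ : Weight) E) ψ.2
      map_add' := by
        intro a b
        rw [← MemLp.toLp_add]
        apply MemLp.toLp_congr
        filter_upwards [Lp.coeFn_add (a : Weight) (b : Weight)] with E hE
        simp only [Submodule.coe_add, Pi.add_apply, hE, mul_add]
      map_smul' := by
        intro c a
        rw [RingHom.id_apply, ← MemLp.toLp_const_smul]
        apply MemLp.toLp_congr
        filter_upwards [Lp.coeFn_smul c (a : Weight)] with E hE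
        simp only [Submodule.coe_smul, Pi.smul_apply, hE, smul_eq_mul]
        ring }

/-- The bounded operator `e^{i H_W s}`: multiplication by `e^{i E s}`. -/
def expWeightHamiltonian (s : ℝ) : Weight →L[ℂ] Weight :=
  ContinuousLinearMap.holderL volume ∞ 2 2 (ContinuousLinearMap.mul ℂ ℂ)
    (MemLp.toLp (fun E : ℝ => cexp (I * E * s))
      (memLp_top_of_bound (by fun_prop) 1
        (Filter.Eventually.of_forall fun E => by
          rw [show I * (E : ℂ) * s = ((E * s : ℝ) : ℂ) * I by push_cast; ring,
            norm_exp_ofReal_mul_I])))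

/-- The displacement operator `Γ_e = e^{-i Δ_W e}`, `Γ_e |E⟩ = |E + e⟩`, that is
`(Γ_e ψ)(E) = ψ(E - e)`; its generator is the time operator `Δ_W = -i d/dE`, and
`Γ_e† H_W Γ_e = H_W + e`. -/
def displacement (e : ℝ) : Weight →L[ℂ] Weight :=
  (Lp.compMeasurePreservingₗᵢ ℂ (fun E : ℝ => E - e)
    (measurePreserving_sub_right volume e)).toContinuousLinearMap

/-- `K(x, y) = ⟨x|ρ|y⟩` is the (square-integrable) integral kernel of `ρ`. -/
structure IsKernel (ρ : Weight →L[ℂ] Weight) (K : ℝ → ℝ → ℂ) : Prop where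
  memLp : MemLp (fun p : ℝ × ℝ => K p.1 p.2) 2 volume
  apply_ae : ∀ ψ : Weight, ρ ψ =ᵐ[volume] fun x => ∫ y, K x y * ψ y

/-- The kernel `⟨x|ρ|y⟩` of `ρ`. Density operators are Hilbert–Schmidt, so that they have one,
and it is unique up to a null set. -/
def kernel (ρ : Weight →L[ℂ] Weight) : ℝ → ℝ → ℂ := Classical.epsilon (IsKernel ρ)

/-- The Wigner function
`W(E, t) = (1 / 2π) ∫ dω e^{i ω t} Tr[ρ |E + ω/2⟩⟨E - ω/2|]`. -/
def wigner (ρ : Weight →L[ℂ] Weight) (E t : ℝ) : ℂ :=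
  1 / (2 * Real.pi) * ∫ ω : ℝ, cexp (I * ω * t) * kernel ρ (E - ω / 2) (E + ω / 2)

/-- The normalized Gaussian wave function
`(2πσ²)^{-1/4} exp(-(E - μ)² / (4σ²) + iνE)`. -/
def gaussianWave (μ ν σ E : ℝ) : ℂ :=
  (((2 * Real.pi * σ ^ 2) ^ (-(1 / 4 : ℝ)) : ℝ) : ℂ) *
    cexp (-(1 / (4 * (σ : ℂ) ^ 2)) * ((E : ℂ) - μ) ^ 2 + I * ν * E)

/-- `ρ = |ψ⟩⟨ψ|` for a Gaussian wave packet `ψ`. -/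
def IsGaussianPacket (ρ : Weight →L[ℂ] Weight) : Prop :=
  ∃ (μ ν σ : ℝ) (ψ : Weight), 0 < σ ∧ ψ =ᵐ[volume] gaussianWave μ ν σ ∧
    ρ = InnerProductSpace.rankOne ℂ ψ ψ

/-! ### The system and the composite of system and weight

The finite-dimensional system is described in an eigenbasis `|εᵢ⟩`, `i : ι`, of its Hamiltonian
`H_S = ∑ᵢ εᵢ |εᵢ⟩⟨εᵢ|`, with arbitrary (possibly degenerate) energies `ε : ι → ℝ`, so that its
operators are `ι × ι` matrices. -/

section System

variable {ι : Type*} [Fintype ι] [DecidableEq ι]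

/-- `H_S = ∑ᵢ εᵢ |εᵢ⟩⟨εᵢ|`. -/
def systemHamiltonian (ε : ι → ℝ) : Matrix ι ι ℂ := Matrix.diagonal fun i => (ε i : ℂ)

/-- `V† H_S V`. -/
def rotatedHamiltonian (ε : ι → ℝ) (V : Matrix ι ι ℂ) : Matrix ι ι ℂ :=
  V.conjTranspose * systemHamiltonian ε * V

/-- The work operator `W_S = H_S - V† H_S V`. -/
def workOperator (ε : ι → ℝ) (V : Matrix ι ι ℂ) : Matrix ι ι ℂ :=
  systemHamiltonian ε - rotatedHamiltonian ε V

/-- `⟨A⟩_ρ = Tr[A ρ]` for the system. -/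
def systemMean (ρ A : Matrix ι ι ℂ) : ℂ := (A * ρ).trace

/-- `Cov_ρ[A, B] = ½⟨AB + BA⟩_ρ - ⟨A⟩_ρ ⟨B⟩_ρ` for the system. -/
def systemCov (ρ A B : Matrix ι ι ℂ) : ℂ :=
  1 / 2 * systemMean ρ (A * B + B * A) - systemMean ρ A * systemMean ρ B

/-- `Var_ρ[A] = Cov_ρ[A, A]` for the system. -/
def systemVar (ρ A : Matrix ι ι ℂ) : ℂ := systemCov ρ A A

/-- A density matrix of the system. -/
structure IsDensityMatrix (ρ : Matrix ι ι ℂ) : Prop where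
  posSemidef : ρ.PosSemidef
  trace_one : ρ.trace = 1

/-- The free evolution `e^{-i H_S t} ρ_S e^{i H_S t}`. -/
def freeEvolution (ε : ι → ℝ) (ρS : Matrix ι ι ℂ) (t : ℝ) : Matrix ι ι ℂ :=
  NormedSpace.exp (-(I * (t : ℂ)) • systemHamiltonian ε) * ρS *
    NormedSpace.exp ((I * (t : ℂ)) • systemHamiltonian ε)

variable (ι) in
/-- The composite Hilbert space `ℂ^ι ⊗ L²(ℝ)`, i.e. families `Ψᵢ(E) = ⟨εᵢ, E|Ψ⟩`. -/
abbrev Joint : Type _ := PiLp 2 fun _ : ι => Weight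

/-- The inclusion `ψ ↦ |εⱼ⟩ ⊗ ψ`. -/
def incl (j : ι) : Weight →L[ℂ] Joint ι :=
  (PiLp.continuousLinearEquiv 2 ℂ fun _ : ι => Weight).symm.toContinuousLinearMap ∘L
    ContinuousLinearMap.single ℂ (fun _ : ι => Weight) j

/-- The component map `Ψ ↦ Ψᵢ`. -/
def comp (i : ι) : Joint ι →L[ℂ] Weight := PiLp.proj 2 (fun _ : ι => Weight) i

/-- `A ⊗ B` for a system operator `A` and a bounded weight operator `B`:
`((A ⊗ B) Ψ)ᵢ = ∑ⱼ Aᵢⱼ B Ψⱼ`. -/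
def tensorOp (A : Matrix ι ι ℂ) (B : Weight →L[ℂ] Weight) : Joint ι →L[ℂ] Joint ι :=
  ∑ i, ∑ j, A i j • (incl i ∘L B ∘L comp j)

/-- The partial trace over the weight, `(Tr_W X)ᵢⱼ = Tr (⟨εᵢ| X |εⱼ⟩)`. -/
def partialTraceW (X : Joint ι →L[ℂ] Joint ι) : Matrix ι ι ℂ :=
  Matrix.of fun i j => trace (comp i ∘L X ∘L incl j)

/-- `1 ⊗ H_W`, with domain `{Ψ | ∀ i, Ψᵢ ∈ dom H_W}`. -/
def jointWeightHamiltonian : Joint ι →ₗ.[ℂ] Joint ι where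
  domain :=
    { carrier := {Ψ | ∀ i, Ψ i ∈ weightHamiltonian.domain}
      add_mem' := fun ha hb i => weightHamiltonian.domain.add_mem (ha i) (hb i)
      zero_mem' := fun _ => weightHamiltonian.domain.zero_mem
      smul_mem' := fun c _ ha i => weightHamiltonian.domain.smul_mem c (ha i) }
  toFun :=
    { toFun := fun Ψ => WithLp.toLp 2 fun i =>
        weightHamiltonian ⟨(Ψ : Joint ι) i, Ψ.2 i⟩
      map_add' := by
        intro a b
        ext1 i
        exact weightHamiltonian.map_add ⟨(a : Joint ι) i, a.2 i⟩
          ⟨(b : Joint ι) i, b.2 i⟩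
      map_smul' := by
        intro c a
        ext1 i
        exact weightHamiltonian.map_smul c ⟨(a : Joint ι) i, a.2 i⟩ }

/-- A system operator `A ⊗ 1` on the composite space. -/
def jointSystemOp (A : Matrix ι ι ℂ) : Joint ι →L[ℂ] Joint ι :=
  tensorOp A (ContinuousLinearMap.id ℂ Weight)

/-- `S = e^{-i H_S ⊗ Δ_W} = ∑ᵢ |εᵢ⟩⟨εᵢ| ⊗ e^{-i εᵢ Δ_W}`, so that `S |εᵢ, E⟩ = |εᵢ, E + εᵢ⟩`. -/
def shiftOp (ε : ι → ℝ) : Joint ι →L[ℂ] Joint ι :=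
  ∑ i, tensorOp (Matrix.single i i 1) (displacement (ε i))

/-- The energy-conserving, translation-invariant unitary `U = S† (V ⊗ 1) S`. -/
def workUnitary (ε : ι → ℝ) (V : Matrix ι ι ℂ) : Joint ι →L[ℂ] Joint ι :=
  ContinuousLinearMap.adjoint (shiftOp ε) ∘L jointSystemOp V ∘L shiftOp ε

/-- The control state `σ = S (ρ_S ⊗ ρ_W) S†`. -/
def controlState (ε : ι → ℝ) (ρS : Matrix ι ι ℂ) (ρW : Weight →L[ℂ] Weight) :
    Joint ι →L[ℂ] Joint ι :=
  shiftOp ε ∘L tensorOp ρS ρW ∘L ContinuousLinearMap.adjoint (shiftOp ε)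

/-- The control-marginal state `σ_S = Tr_W [S (ρ_S ⊗ ρ_W) S†]`. -/
def controlMarginal (ε : ι → ℝ) (ρS : Matrix ι ι ℂ) (ρW : Weight →L[ℂ] Weight) :
    Matrix ι ι ℂ :=
  partialTraceW (controlState ε ρS ρW)

/-- The denominator `Tr[e^{i H_W s} ρ_W]` of `ξ_S(s)`. -/
def xiDenominator (ρW : Weight →L[ℂ] Weight) (s : ℝ) : ℂ :=
  trace (expWeightHamiltonian s ∘L ρW)

/-- `ξ_S(s) = (∫ dt ∫ dE e^{i E s} W(E, t) e^{-i H_S t} ρ_S e^{i H_S t}) / Tr[e^{i H_W s} ρ_W]`,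
with the matrix-valued integral taken entrywise. -/
def xi (ε : ι → ℝ) (ρS : Matrix ι ι ℂ) (ρW : Weight →L[ℂ] Weight) (s : ℝ) : Matrix ι ι ℂ :=
  Matrix.of fun i j =>
    (∫ t : ℝ, (∫ E : ℝ, cexp (I * E * s) * wigner ρW E t) * freeEvolution ε ρS t i j) /
      xiDenominator ρW s

/-- `ρ_S ⊗ ρ_W` is semi-classical: `ξ_S(s) = σ_S` for every `s` at which `ξ_S(s)` is defined,
i.e. at which its denominator does not vanish (this includes a neighbourhood of `s = 0`). -/
def IsSemiclassical (ε : ι → ℝ) (ρS : Matrix ι ι ℂ) (ρW : Weight →L[ℂ] Weight) : Prop :=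
  ∀ s : ℝ, xiDenominator ρW s ≠ 0 → xi ε ρS ρW s = controlMarginal ε ρS ρW

/-- `Δσ_W² = Var_ρ[U† H_W U] - Var_ρ[H_W]` for `ρ = ρ_S ⊗ ρ_W`. -/
def varianceChange (ε : ι → ℝ) (V ρS : Matrix ι ι ℂ) (ρW : Weight →L[ℂ] Weight) : ℝ :=
  var (tensorOp ρS ρW) (conjBy (workUnitary ε V) jointWeightHamiltonian)
    - var (tensorOp ρS ρW) jointWeightHamiltonian

/-- `F = Cov_σ[H_S - H_W, V† H_S V]`. -/
def fTerm (ε : ι → ℝ) (V ρS : Matrix ι ι ℂ) (ρW : Weight →L[ℂ] Weight) : ℝ :=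
  cov (controlState ε ρS ρW)
    (ofBounded (jointSystemOp (systemHamiltonian ε)) - jointWeightHamiltonian)
    (ofBounded (jointSystemOp (rotatedHamiltonian ε V)))

end System

end QuantumWeight

end

/-!
Let `T = √ρ_W`, `Y = H_W T` and `s = √ρ_S`, so that `R = s ⊗ T` is `√ρ` and `Z = s ⊗ Y` is `H_W √ρ`.
All moments become Hilbert–Schmidt inner products. For a system operator `A` let
`Ã = S† (A ⊗ 1) S`; then `⟨R, Ã R⟩ = ⟨A⟩_{σ_S}`, and `U† H_W U = H_W + W̃_S`, so that
`Δσ_W² = Var_{σ_S}[W_S] + 2 C(W_S)`, where `C(A)` is the covariance of `Z` and `Ã R`. Since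
`(H_S - H_W) S = -S H_W`, also `F = -C(V† H_S V)`. It remains to see that `C` vanishes on Hermitian
operators in a semi-classical state.

Put `χ(ω, s) = Tr[e^{i H_W s} Γ_ω ρ_W]`. Integrating out the Wigner function turns
semi-classicality into `(ρ_S)ᵢⱼ χ(εᵢ - εⱼ, s) = (σ_S)ᵢⱼ e^{i (εᵢ - εⱼ) s / 2} χ(0, s)`. Its
derivative at `s = 0` is `(ρ_S)ᵢⱼ ⟨Y, Γ_{εᵢ - εⱼ} T⟩ = (σ_S)ᵢⱼ (⟨Y, T⟩ + (εᵢ - εⱼ) / 2)`, hence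
`⟨Z, Ã R⟩ = ⟨Y, T⟩ ⟨A⟩_{σ_S} + ½ ⟨[A, H_S]⟩_{σ_S}`. The last mean is purely imaginary for Hermitian
`A`, so the real part factors and `C(A) = 0`.

For a Gaussian packet the identity for `χ` is a computation with Gaussian integrals; for a state
commuting with `H_S` it is trivial, as `εᵢ = εⱼ` whenever `(ρ_S)ᵢⱼ ≠ 0`.
-/

noncomputable section

namespace QuantumWeight

section HilbertSchmidt

open ContinuousLinearMap (adjoint)

variable {H₁ H₂ H₃ : Type*}
  [NormedAddCommGroup H₁] [InnerProductSpace ℂ H₁] [CompleteSpace H₁]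
  [NormedAddCommGroup H₂] [InnerProductSpace ℂ H₂]
  [NormedAddCommGroup H₃] [InnerProductSpace ℂ H₃]

/-- A Hilbert–Schmidt operator: the images of the fixed Hilbert basis are square-summable. -/
def IsHilbertSchmidt (X : H₁ →L[ℂ] H₂) : Prop :=
  Memℓp (fun k : basisIndex H₁ => X (onb H₁ k)) 2

/-- The Hilbert–Schmidt inner product `Tr[X† Y]`. -/
def hsInner (X Y : H₁ →L[ℂ] H₂) : ℂ := ∑' k, ⟪X (onb H₁ k), Y (onb H₁ k)⟫_ℂ

/-- The images of the fixed Hilbert basis under a Hilbert–Schmidt operator, as an element of an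
`ℓ²` space; this identifies `hsInner` with the inner product of that space. -/
def IsHilbertSchmidt.vec {X : H₁ →L[ℂ] H₂} (hX : IsHilbertSchmidt X) :
    lp (fun _ : basisIndex H₁ => H₂) 2 := ⟨_, hX⟩

theorem isHilbertSchmidt_iff_summable {X : H₁ →L[ℂ] H₂} :
    IsHilbertSchmidt X ↔ Summable fun k => ‖X (onb H₁ k)‖ ^ 2 := by
  rw [IsHilbertSchmidt, memℓp_gen_iff (by norm_num)]
  simp

namespace IsHilbertSchmidt

variable {X Y : H₁ →L[ℂ] H₂}

theorem inner_vec (hX : IsHilbertSchmidt X) (hY : IsHilbertSchmidt Y) :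
    ⟪hX.vec, hY.vec⟫_ℂ = hsInner X Y :=
  lp.inner_eq_tsum _ _

theorem summable_inner (hX : IsHilbertSchmidt X) (hY : IsHilbertSchmidt Y) :
    Summable fun k => ⟪X (onb H₁ k), Y (onb H₁ k)⟫_ℂ :=
  lp.summable_inner hX.vec hY.vec

theorem add (hX : IsHilbertSchmidt X) (hY : IsHilbertSchmidt Y) : IsHilbertSchmidt (X + Y) :=
  Memℓp.add hX hY

theorem neg (hX : IsHilbertSchmidt X) : IsHilbertSchmidt (-X) :=
  Memℓp.neg hX

theorem smul (hX : IsHilbertSchmidt X) (c : ℂ) : IsHilbertSchmidt (c • X) :=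
  Memℓp.const_smul hX c

theorem sum {κ : Type*} {s : Finset κ} {X : κ → H₁ →L[ℂ] H₂}
    (hX : ∀ i ∈ s, IsHilbertSchmidt (X i)) : IsHilbertSchmidt (∑ i ∈ s, X i) := by
  simpa only [IsHilbertSchmidt, _root_.sum_apply] using Memℓp.finsetSum s hX

theorem comp_left (hX : IsHilbertSchmidt X) (A : H₂ →L[ℂ] H₃) : IsHilbertSchmidt (A ∘L X) := by
  rw [isHilbertSchmidt_iff_summable] at hX ⊢
  refine Summable.of_nonneg_of_le (fun k => by positivity) (fun k => ?_) (hX.mul_left (‖A‖ ^ 2))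
  rw [← mul_pow]
  gcongr
  exact A.le_opNorm _

end IsHilbertSchmidt

theorem hsInner_conj_symm (X Y : H₁ →L[ℂ] H₂) : starRingEnd ℂ (hsInner X Y) = hsInner Y X := by
  simp only [hsInner, Complex.conj_tsum, inner_conj_symm]

theorem hsInner_re_comm (X Y : H₁ →L[ℂ] H₂) : (hsInner X Y).re = (hsInner Y X).re := by
  rw [← hsInner_conj_symm, Complex.conj_re]

theorem hsInner_add_right {X Y Z : H₁ →L[ℂ] H₂} (hX : IsHilbertSchmidt X)
    (hY : IsHilbertSchmidt Y) (hZ : IsHilbertSchmidt Z) :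
    hsInner X (Y + Z) = hsInner X Y + hsInner X Z := by
  rw [← hX.inner_vec (hY.add hZ), ← hX.inner_vec hY, ← hX.inner_vec hZ]
  exact inner_add_right hX.vec hY.vec hZ.vec

theorem hsInner_add_left {X Y Z : H₁ →L[ℂ] H₂} (hX : IsHilbertSchmidt X)
    (hY : IsHilbertSchmidt Y) (hZ : IsHilbertSchmidt Z) :
    hsInner (X + Y) Z = hsInner X Z + hsInner Y Z := by
  rw [← hsInner_conj_symm, hsInner_add_right hZ hX hY, map_add, hsInner_conj_symm,
    hsInner_conj_symm]

theorem hsInner_smul_right (c : ℂ) (X Y : H₁ →L[ℂ] H₂) :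
    hsInner X (c • Y) = c * hsInner X Y := by
  simp only [hsInner, _root_.smul_apply, inner_smul_right, tsum_mul_left]

theorem hsInner_smul_left (c : ℂ) (X Y : H₁ →L[ℂ] H₂) :
    hsInner (c • X) Y = starRingEnd ℂ c * hsInner X Y := by
  simp only [hsInner, _root_.smul_apply, inner_smul_left, tsum_mul_left]

theorem hsInner_neg_left (X Y : H₁ →L[ℂ] H₂) : hsInner (-X) Y = -hsInner X Y := by
  simp only [hsInner, _root_.neg_apply, inner_neg_left, tsum_neg]

theorem hsInner_neg_right (X Y : H₁ →L[ℂ] H₂) : hsInner X (-Y) = -hsInner X Y := by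
  simp only [hsInner, _root_.neg_apply, inner_neg_right, tsum_neg]

theorem hsInner_sum_right {κ : Type*} (s : Finset κ) {X : H₁ →L[ℂ] H₂} {Y : κ → H₁ →L[ℂ] H₂}
    (hX : IsHilbertSchmidt X) (hY : ∀ i, IsHilbertSchmidt (Y i)) :
    hsInner X (∑ i ∈ s, Y i) = ∑ i ∈ s, hsInner X (Y i) := by
  simp only [hsInner, _root_.sum_apply, inner_sum]
  exact Summable.tsum_finsetSum fun i _ => hX.summable_inner (hY i)

theorem hsInner_self (X : H₁ →L[ℂ] H₂) :
    hsInner X X = ((∑' k, ‖X (onb H₁ k)‖ ^ 2 : ℝ) : ℂ) := by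
  simp only [hsInner, inner_self_eq_norm_sq_to_K, Complex.ofReal_tsum, Complex.ofReal_pow]
  rfl

theorem sq_norm_hsInner_le {X Y : H₁ →L[ℂ] H₂} (hX : IsHilbertSchmidt X)
    (hY : IsHilbertSchmidt Y) :
    ‖hsInner X Y‖ ^ 2 ≤ (hsInner X X).re * (hsInner Y Y).re := by
  have h := norm_inner_le_norm (𝕜 := ℂ) hX.vec hY.vec
  rw [← hX.inner_vec hY, ← hX.inner_vec hX, ← hY.inner_vec hY]
  calc ‖⟪hX.vec, hY.vec⟫_ℂ‖ ^ 2 ≤ (‖hX.vec‖ * ‖hY.vec‖) ^ 2 := by gcongr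
    _ = (⟪hX.vec, hX.vec⟫_ℂ).re * (⟪hY.vec, hY.vec⟫_ℂ).re := by
      rw [mul_pow, norm_sq_eq_re_inner (𝕜 := ℂ) hX.vec, norm_sq_eq_re_inner (𝕜 := ℂ) hY.vec]
      rfl

/-- The covariance `Re⟨X, Y⟩ - Re⟨Q, X⟩ Re⟨Q, Y⟩` of two Hilbert–Schmidt operators relative to a
third one; for `Q = √ρ`, `X = A√ρ`, `Y = B√ρ` it is `Cov_ρ[A, B]`. -/
def hsCov (Q X Y : H₁ →L[ℂ] H₂) : ℝ :=
  (hsInner X Y).re - (hsInner Q X).re * (hsInner Q Y).re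

theorem hsCov_neg_left (Q X Y : H₁ →L[ℂ] H₂) : hsCov Q (-X) Y = -hsCov Q X Y := by
  simp only [hsCov, hsInner_neg_left, hsInner_neg_right, Complex.neg_re]
  ring

theorem hsCov_add_self {Q X Y : H₁ →L[ℂ] H₂} (hQ : IsHilbertSchmidt Q)
    (hX : IsHilbertSchmidt X) (hY : IsHilbertSchmidt Y) :
    hsCov Q (X + Y) (X + Y) = hsCov Q X X + 2 * hsCov Q X Y + hsCov Q Y Y := by
  simp only [hsCov, hsInner_add_right hQ hX hY, hsInner_add_left hX hY (hX.add hY),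
    hsInner_add_right hX hX hY, hsInner_add_right hY hX hY, Complex.add_re, hsInner_re_comm Y X]
  ring

theorem hsCov_self_nonneg {Q X : H₁ →L[ℂ] H₂} (hQ : IsHilbertSchmidt Q)
    (hX : IsHilbertSchmidt X) (h1 : hsInner Q Q = 1) : 0 ≤ hsCov Q X X := by
  have hCS := sq_norm_hsInner_le hQ hX
  rw [h1, Complex.one_re, one_mul] at hCS
  have hre : (hsInner Q X).re ^ 2 ≤ ‖hsInner Q X‖ ^ 2 :=
    sq_le_sq' (neg_le_of_abs_le (Complex.abs_re_le_norm _)) (Complex.re_le_norm _)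
  rw [hsCov, ← sq]
  linarith

variable [CompleteSpace H₂] [CompleteSpace H₃]

theorem hasSum_norm_inner_onb_sq (x : H₁) :
    HasSum (fun k => ‖⟪onb H₁ k, x⟫_ℂ‖ ^ 2) (‖x‖ ^ 2) := by
  simpa [HilbertBasis.repr_apply_apply] using
    lp.hasSum_norm (p := 2) (by norm_num) ((onb H₁).repr x)

theorem IsHilbertSchmidt.summable_matrix {X : H₁ →L[ℂ] H₂} (hX : IsHilbertSchmidt X) :
    Summable fun p : basisIndex H₁ × basisIndex H₂ =>
      ‖⟪onb H₂ p.2, X (onb H₁ p.1)⟫_ℂ‖ ^ 2 := by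
  rw [summable_prod_of_nonneg fun p => sq_nonneg _]
  refine ⟨fun k => (hasSum_norm_inner_onb_sq (X (onb H₁ k))).summable, ?_⟩
  simpa only [(hasSum_norm_inner_onb_sq _).tsum_eq] using isHilbertSchmidt_iff_summable.1 hX

theorem IsHilbertSchmidt.adjoint {X : H₁ →L[ℂ] H₂} (hX : IsHilbertSchmidt X) :
    IsHilbertSchmidt (adjoint X) := by
  have h := (summable_prod_of_nonneg fun p => sq_nonneg _).1 hX.summable_matrix.prod_symm
  refine isHilbertSchmidt_iff_summable.2 (h.2.congr fun k => ?_)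
  rw [← (hasSum_norm_inner_onb_sq _).tsum_eq]
  refine tsum_congr fun l => ?_
  rw [ContinuousLinearMap.adjoint_inner_right, norm_inner_symm, Prod.swap]

theorem IsHilbertSchmidt.comp_right {X : H₂ →L[ℂ] H₃} (hX : IsHilbertSchmidt X)
    (A : H₁ →L[ℂ] H₂) : IsHilbertSchmidt (X ∘L A) := by
  simpa only [← ContinuousLinearMap.adjoint_comp, ContinuousLinearMap.adjoint_adjoint]
    using (hX.adjoint.comp_left (ContinuousLinearMap.adjoint A)).adjoint

theorem hsInner_adjoint {X Y : H₁ →L[ℂ] H₂} (hX : IsHilbertSchmidt X)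
    (hY : IsHilbertSchmidt Y) :
    hsInner (adjoint Y) (adjoint X) = hsInner X Y := by
  let c (k : basisIndex H₁) (l : basisIndex H₂) : ℂ :=
    ⟪X (onb H₁ k), onb H₂ l⟫_ℂ * ⟪onb H₂ l, Y (onb H₁ k)⟫_ℂ
  have hc : Summable (Function.uncurry c) := by
    refine Summable.of_norm_bounded (hX.summable_matrix.add hY.summable_matrix) fun p => ?_
    rw [Function.uncurry, norm_mul, norm_inner_symm]
    nlinarith [sq_nonneg (‖⟪onb H₂ p.2, X (onb H₁ p.1)⟫_ℂ‖ - ‖⟪onb H₂ p.2, Y (onb H₁ p.1)⟫_ℂ‖)]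
  have hrow (k) : ⟪X (onb H₁ k), Y (onb H₁ k)⟫_ℂ = ∑' l, c k l :=
    ((onb H₂).tsum_inner_mul_inner _ _).symm
  have hcol (l) : ⟪adjoint Y (onb H₂ l), adjoint X (onb H₂ l)⟫_ℂ = ∑' k, c k l := by
    rw [← (onb H₁).tsum_inner_mul_inner]
    refine tsum_congr fun k => ?_
    rw [ContinuousLinearMap.adjoint_inner_left, ContinuousLinearMap.adjoint_inner_right, mul_comm]
  simp only [hsInner, hrow, hcol]
  exact hc.tsum_comm

theorem hsInner_comp_left (A : H₂ →L[ℂ] H₃) (X : H₁ →L[ℂ] H₂) (Y : H₁ →L[ℂ] H₃) :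
    hsInner (A ∘L X) Y = hsInner X (adjoint A ∘L Y) := by
  simp only [hsInner, ContinuousLinearMap.comp_apply, ContinuousLinearMap.adjoint_inner_right]

theorem hsInner_comp_right {X : H₂ →L[ℂ] H₃} {Y : H₁ →L[ℂ] H₃} (hX : IsHilbertSchmidt X)
    (hY : IsHilbertSchmidt Y) (A : H₁ →L[ℂ] H₂) :
    hsInner (X ∘L A) Y = hsInner X (Y ∘L adjoint A) := by
  rw [← hsInner_adjoint (hX.comp_right _) hY, ← hsInner_adjoint hX (hY.comp_right _),
    ContinuousLinearMap.adjoint_comp, ContinuousLinearMap.adjoint_comp,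
    ContinuousLinearMap.adjoint_adjoint, hsInner_comp_left]

theorem trace_comp (A : H₁ →L[ℂ] H₁) (X : H₁ →L[ℂ] H₁) :
    trace (A ∘L X) = hsInner (adjoint A) X := by
  simp only [trace, hsInner, ContinuousLinearMap.comp_apply,
    ContinuousLinearMap.adjoint_inner_left]

theorem hsInner_conj {X Y : H₁ →L[ℂ] H₁} (hX : IsHilbertSchmidt X)
    (hY : IsHilbertSchmidt Y) {A : H₁ →L[ℂ] H₂}
    (hA : adjoint A ∘L A = ContinuousLinearMap.id ℂ H₁) :
    hsInner (A ∘L X ∘L adjoint A) (A ∘L Y ∘L adjoint A) = hsInner X Y := by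
  rw [hsInner_comp_left, ← ContinuousLinearMap.comp_assoc, hA, ContinuousLinearMap.id_comp,
    hsInner_comp_right hX (hY.comp_right _), ContinuousLinearMap.adjoint_adjoint,
    ContinuousLinearMap.comp_assoc, hA, ContinuousLinearMap.comp_id]

theorem hsCov_conj {Q X Y : H₁ →L[ℂ] H₁} (hQ : IsHilbertSchmidt Q) (hX : IsHilbertSchmidt X)
    (hY : IsHilbertSchmidt Y) {A : H₁ →L[ℂ] H₂}
    (hA : adjoint A ∘L A = ContinuousLinearMap.id ℂ H₁) :
    hsCov (A ∘L Q ∘L adjoint A) (A ∘L X ∘L adjoint A) (A ∘L Y ∘L adjoint A) = hsCov Q X Y := by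
  simp only [hsCov, hsInner_conj hX hY hA, hsInner_conj hQ hX hA, hsInner_conj hQ hY hA]

end HilbertSchmidt

section DensityOperator

open ContinuousLinearMap (adjoint)

variable {H : Type*} [NormedAddCommGroup H] [InnerProductSpace ℂ H] [CompleteSpace H]
  {ρ : H →L[ℂ] H}

/-- The positive square root `√ρ`. A named constant keeps the instance problems of the continuous
functional calculus away from concrete spaces such as `Weight`. -/
def sqrtOp (ρ : H →L[ℂ] H) : H →L[ℂ] H := CFC.sqrt ρ

theorem sqrtOp_comp_self (hρ : ρ.IsPositive) : sqrtOp ρ ∘L sqrtOp ρ = ρ :=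
  CFC.sqrt_mul_sqrt_self ρ ((ContinuousLinearMap.nonneg_iff_isPositive ρ).2 hρ)

theorem isPositive_sqrtOp (ρ : H →L[ℂ] H) : (sqrtOp ρ).IsPositive :=
  (ContinuousLinearMap.nonneg_iff_isPositive _).1 (CFC.sqrt_nonneg ρ)

theorem adjoint_sqrtOp (ρ : H →L[ℂ] H) : adjoint (sqrtOp ρ) = sqrtOp ρ :=
  (isPositive_sqrtOp ρ).isSelfAdjoint.adjoint_eq

theorem sqrtOp_eq_of_comp_self {T : H →L[ℂ] H} (h : T ∘L T = ρ) (hT : T.IsPositive) :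
    sqrtOp ρ = T :=
  CFC.sqrt_unique h ((ContinuousLinearMap.nonneg_iff_isPositive T).2 hT)

theorem inner_apply_eq_norm_sqrtOp_sq (hρ : ρ.IsPositive) (x : H) :
    ⟪x, ρ x⟫_ℂ = ((‖sqrtOp ρ x‖ ^ 2 : ℝ) : ℂ) := by
  conv_lhs => rw [← sqrtOp_comp_self hρ, ContinuousLinearMap.comp_apply]
  rw [← ContinuousLinearMap.adjoint_inner_left, adjoint_sqrtOp, inner_self_eq_norm_sq_to_K,
    Complex.ofReal_pow]
  rfl

namespace IsDensityOperator

theorem isHilbertSchmidt_sqrtOp (hρ : IsDensityOperator ρ) : IsHilbertSchmidt (sqrtOp ρ) := by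
  have h := hρ.hasSum_one.summable
  simp only [inner_apply_eq_norm_sqrtOp_sq hρ.isPositive] at h
  exact isHilbertSchmidt_iff_summable.2 (Complex.summable_ofReal.1 h)

theorem hsInner_sqrtOp_self (hρ : IsDensityOperator ρ) :
    hsInner (sqrtOp ρ) (sqrtOp ρ) = 1 := by
  rw [← hρ.hasSum_one.tsum_eq, hsInner_self, Complex.ofReal_tsum]
  simp only [inner_apply_eq_norm_sqrtOp_sq hρ.isPositive]

theorem trace_comp_self (hρ : IsDensityOperator ρ) (A : H →L[ℂ] H) :
    trace (A ∘L ρ) = hsInner (sqrtOp ρ) (A ∘L sqrtOp ρ) := by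
  have hT := hρ.isHilbertSchmidt_sqrtOp
  conv_lhs => rw [← sqrtOp_comp_self hρ.isPositive, ← ContinuousLinearMap.comp_assoc]
  rw [trace_comp, ← hsInner_adjoint hT (hT.comp_left A), adjoint_sqrtOp]

end IsDensityOperator

end DensityOperator

section PartialOperators

open ContinuousLinearMap (adjoint)

variable {H₁ H : Type*} [NormedAddCommGroup H₁] [InnerProductSpace ℂ H₁]
  [NormedAddCommGroup H] [InnerProductSpace ℂ H] {A B : H →ₗ.[ℂ] H} {T Y Z : H₁ →L[ℂ] H}

/-- `A T = Y` as everywhere defined operators, for a partially defined `A` and bounded `T`, `Y`: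
the range of `T` lies in the domain of `A`. -/
def IsComp (A : H →ₗ.[ℂ] H) (T Y : H₁ →L[ℂ] H) : Prop :=
  ∀ x, ∃ hx : T x ∈ A.domain, A ⟨T x, hx⟩ = Y x

theorem mem_graph_iff_exists {x y : H} :
    (x, y) ∈ A.graph ↔ ∃ hx : x ∈ A.domain, A ⟨x, hx⟩ = y := by
  rw [LinearPMap.mem_graph_iff]
  exact ⟨fun ⟨⟨_, hz⟩, h, hy⟩ => by subst h; exact ⟨hz, hy⟩, fun ⟨hx, hy⟩ => ⟨⟨x, hx⟩, rfl, hy⟩⟩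

theorem app_of_mem {x : H} (hx : x ∈ A.domain) : app A x = A ⟨x, hx⟩ :=
  dif_pos hx

theorem IsComp.app_eq (h : IsComp A T Y) (x : H₁) : app A (T x) = Y x :=
  (app_of_mem (h x).1).trans (h x).2

theorem IsComp.sub (hA : IsComp A T Y) (hB : IsComp B T Z) : IsComp (A - B) T (Y - Z) :=
  fun x => ⟨⟨(hA x).1, (hB x).1⟩, congrArg₂ (· - ·) (hA x).2 (hB x).2⟩

theorem IsComp.smul (h : IsComp A T Y) (c : ℂ) : IsComp A (c • T) (c • Y) :=
  fun x => ⟨A.domain.smul_mem c (h x).1,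
    (A.map_smul c ⟨T x, (h x).1⟩).trans (congrArg (c • ·) (h x).2)⟩

theorem IsComp.sum {κ : Type*} {s : Finset κ} {T Y : κ → H₁ →L[ℂ] H}
    (h : ∀ i, IsComp A (T i) (Y i)) : IsComp A (∑ i ∈ s, T i) (∑ i ∈ s, Y i) := fun x => by
  have hsum := A.graph.sum_mem (t := s) fun i _ => mem_graph_iff_exists.2 (h i x)
  rw [← prod_mk_sum] at hsum
  simpa only [sum_apply] using mem_graph_iff_exists.1 hsum

theorem isComp_ofBounded (C : H →L[ℂ] H) (T : H₁ →L[ℂ] H) : IsComp (ofBounded C) T (C ∘L T) :=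
  fun _ => ⟨Submodule.mem_top, rfl⟩

theorem IsComp.comp_right {H₀ : Type*} [NormedAddCommGroup H₀] [InnerProductSpace ℂ H₀]
    (h : IsComp A T Y) (C : H₀ →L[ℂ] H₁) : IsComp A (T ∘L C) (Y ∘L C) :=
  fun x => h (C x)

variable [CompleteSpace H]

theorem IsComp.conjBy {U : H →L[ℂ] H} (h : IsComp A (U ∘L T) Y) :
    IsComp (conjBy U A) T (adjoint U ∘L Y) :=
  fun x => ⟨(h x).1, congrArg (adjoint U) (h x).2⟩

variable {ρ X Y : H →L[ℂ] H}

theorem IsComp.hasFiniteSecondMoment (h : IsComp A (sqrtOp ρ) Y) (hY : IsHilbertSchmidt Y) :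
    HasFiniteSecondMoment A ρ where
  mem_domain k := (h _).1
  summable := by simpa only [← sqrtOp.eq_1, h.app_eq] using isHilbertSchmidt_iff_summable.1 hY

theorem mean_eq_re_hsInner (hρ : IsHilbertSchmidt (sqrtOp ρ)) (hX : IsHilbertSchmidt X)
    (hA : IsComp A (sqrtOp ρ) X) : mean ρ A = (hsInner (sqrtOp ρ) X).re := by
  simp only [mean, ← sqrtOp.eq_1, hA.app_eq, hsInner, Complex.re_tsum (hρ.summable_inner hX)]

theorem cov_eq_hsCov (hρ : IsHilbertSchmidt (sqrtOp ρ)) (hX : IsHilbertSchmidt X)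
    (hY : IsHilbertSchmidt Y) (hA : IsComp A (sqrtOp ρ) X) (hB : IsComp B (sqrtOp ρ) Y) :
    cov ρ A B = hsCov (sqrtOp ρ) X Y := by
  rw [cov, hsCov, mean_eq_re_hsInner hρ hX hA, mean_eq_re_hsInner hρ hY hB]
  simp only [← sqrtOp.eq_1, hA.app_eq, hB.app_eq, hsInner,
    Complex.re_tsum (hX.summable_inner hY)]

end PartialOperators

section ClosedOperators

variable {H₁ H₂ : Type*} [NormedAddCommGroup H₁] [InnerProductSpace ℂ H₁] [CompleteSpace H₁]
  [NormedAddCommGroup H₂] [InnerProductSpace ℂ H₂]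

theorem summable_and_tsum_norm_inner_smul_le {v : basisIndex H₁ → H₂}
    (hv : Summable fun k => ‖v k‖ ^ 2) (x : H₁) :
    (Summable fun k => ‖⟪onb H₁ k, x⟫_ℂ • v k‖) ∧
      ∑' k, ‖⟪onb H₁ k, x⟫_ℂ • v k‖ ≤ √(∑' k, ‖v k‖ ^ 2) * ‖x‖ := by
  have hx := hasSum_norm_inner_onb_sq x
  have h := Real.summable_and_inner_le_Lp_mul_Lq_tsum_of_nonneg
    (f := fun k => ‖⟪onb H₁ k, x⟫_ℂ‖) (g := fun k => ‖v k‖) Real.HolderConjugate.two_two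
    (fun k => norm_nonneg _) (fun k => norm_nonneg _)
    (by simpa only [Real.rpow_two] using hx.summable) (by simpa only [Real.rpow_two] using hv)
  simp only [Real.rpow_two, hx.tsum_eq, ← norm_smul, ← Real.sqrt_eq_rpow,
    Real.sqrt_sq (norm_nonneg x)] at h
  exact ⟨h.1, h.2.trans_eq (mul_comm _ _)⟩

theorem hasSum_inner_smul_apply (T : H₁ →L[ℂ] H₂) (x : H₁) :
    HasSum (fun k => ⟪onb H₁ k, x⟫_ℂ • T (onb H₁ k)) (T x) := by
  simpa only [map_smul, HilbertBasis.repr_apply_apply] using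
    T.hasSum ((onb H₁).hasSum_repr x)

variable [CompleteSpace H₂]

theorem exists_hasSum_inner_smul {v : basisIndex H₁ → H₂} (hv : Summable fun k => ‖v k‖ ^ 2) :
    ∃ X : H₁ →L[ℂ] H₂, ∀ x, HasSum (fun k => ⟪onb H₁ k, x⟫_ℂ • v k) (X x) := by
  have key := summable_and_tsum_norm_inner_smul_le hv
  have hs (x : H₁) := (key x).1.of_norm
  let X : H₁ →ₗ[ℂ] H₂ :=
    { toFun := fun x => ∑' k, ⟪onb H₁ k, x⟫_ℂ • v k
      map_add' := fun x y => by
        simp only [inner_add_right, add_smul]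
        exact (hs x).tsum_add (hs y)
      map_smul' := fun c x => by
        simp only [inner_smul_right, mul_smul, RingHom.id_apply]
        exact (hs x).tsum_const_smul c }
  exact ⟨X.mkContinuous _ fun x => (norm_tsum_le_tsum_norm (key x).1).trans (key x).2,
    fun x => (hs x).hasSum⟩

theorem exists_isHilbertSchmidt_isComp {A : H₂ →ₗ.[ℂ] H₂} (hA : A.IsClosed) {T : H₁ →L[ℂ] H₂}
    (hT : ∀ k, T (onb H₁ k) ∈ A.domain) (hs : Summable fun k => ‖app A (T (onb H₁ k))‖ ^ 2) :
    ∃ Y : H₁ →L[ℂ] H₂, IsHilbertSchmidt Y ∧ IsComp A T Y := by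
  obtain ⟨Y, hY⟩ := exists_hasSum_inner_smul hs
  have hgraph : IsComp A T Y := fun x => mem_graph_iff_exists.1 <|
    hA.mem_of_tendsto ((hasSum_inner_smul_apply T x).prodMk (hY x)) <| .of_forall fun s =>
      A.graph.sum_mem fun k _ => A.graph.smul_mem _
        (mem_graph_iff_exists.2 ⟨hT k, (app_of_mem (hT k)).symm⟩)
  exact ⟨Y, isHilbertSchmidt_iff_summable.2 (by simpa only [hgraph.app_eq] using hs), hgraph⟩

theorem countable_basisIndex [SecondCountableTopology H₁] : Countable (basisIndex H₁) := by
  have hd (k l : basisIndex H₁) (hkl : k ≠ l) : 1 < dist (onb H₁ k) (onb H₁ l) := by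
    have h2 : ‖onb H₁ k - onb H₁ l‖ ^ 2 = 2 := by
      rw [@norm_sub_sq ℂ, (onb H₁).orthonormal.2 hkl, (onb H₁).orthonormal.1,
        (onb H₁).orthonormal.1]
      norm_num
    rw [dist_eq_norm]
    nlinarith [norm_nonneg (onb H₁ k - onb H₁ l)]
  refine Pairwise.countable_of_isOpen_disjoint (s := fun k => Metric.ball (onb H₁ k) (1 / 2))
    (fun k l hkl => ?_) (fun k => Metric.isOpen_ball) fun k => Metric.nonempty_ball.2 one_half_pos
  exact Metric.ball_disjoint_ball (by linarith [hd k l hkl])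

end ClosedOperators

section Weight

open ContinuousLinearMap (adjoint)

instance : SecondCountableTopology Weight :=
  haveI : Fact ((2 : ℝ≥0∞) ≠ ∞) := ⟨by norm_num⟩
  Lp.SecondCountableTopology

instance : Countable (basisIndex Weight) := countable_basisIndex

theorem displacement_apply_ae (e : ℝ) (ψ : Weight) :
    displacement e ψ =ᵐ[volume] fun E => ψ (E - e) :=
  Lp.coeFn_compMeasurePreserving ψ (measurePreserving_sub_right volume e)

theorem ae_comp_sub {p : ℝ → Prop} (h : ∀ᵐ E, p E) (e : ℝ) : ∀ᵐ E, p (E - e) :=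
  (measurePreserving_sub_right volume e).quasiMeasurePreserving.ae h

theorem displacement_comp (e f : ℝ) :
    displacement e ∘L displacement f = displacement (e + f) := by
  ext1 ψ
  apply Lp.ext
  filter_upwards [displacement_apply_ae e (displacement f ψ),
    ae_comp_sub (displacement_apply_ae f ψ) e, displacement_apply_ae (e + f) ψ] with E h1 h2 h3
  rw [ContinuousLinearMap.comp_apply, h1, h2, h3, sub_sub]

theorem displacement_zero : displacement 0 = ContinuousLinearMap.id ℂ Weight := by
  ext1 ψ
  apply Lp.ext
  filter_upwards [displacement_apply_ae 0 ψ] with E h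
  rw [h, sub_zero, ContinuousLinearMap.id_apply]

theorem adjoint_displacement (e : ℝ) : adjoint (displacement e) = displacement (-e) := by
  refine (ContinuousLinearMap.eq_adjoint_iff _ _).2 (fun φ ψ => ?_) |>.symm
  calc ⟪displacement (-e) φ, ψ⟫_ℂ
      = ⟪displacement e (displacement (-e) φ), displacement e ψ⟫_ℂ :=
        (LinearIsometry.inner_map_map _ _ _).symm
    _ = ⟪φ, displacement e ψ⟫_ℂ := by
        rw [← ContinuousLinearMap.comp_apply, displacement_comp, add_neg_cancel,
          displacement_zero, ContinuousLinearMap.id_apply]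

theorem holderL_mul_apply_ae {g : ℝ → ℂ} (hg : MemLp g ∞) (ψ : Weight) :
    ContinuousLinearMap.holderL volume ∞ 2 2 (ContinuousLinearMap.mul ℂ ℂ) (hg.toLp g) ψ
      =ᵐ[volume] fun E => g E * ψ E := by
  filter_upwards [ContinuousLinearMap.coeFn_holder (r := 2) (ContinuousLinearMap.mul ℂ ℂ)
    (hg.toLp g) ψ, hg.coeFn_toLp] with E h1 h2
  exact h1.trans (by rw [h2, ContinuousLinearMap.mul_apply'])

theorem expWeightHamiltonian_apply_ae (s : ℝ) (ψ : Weight) :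
    expWeightHamiltonian s ψ =ᵐ[volume] fun E => cexp (I * E * s) * ψ E :=
  holderL_mul_apply_ae _ ψ

theorem mem_graph_weightHamiltonian {ψ θ : Weight} :
    (ψ, θ) ∈ weightHamiltonian.graph ↔ θ =ᵐ[volume] fun E => (E : ℂ) * ψ E := by
  rw [LinearPMap.mem_graph_iff]
  constructor
  · rintro ⟨z, rfl, rfl⟩
    exact MemLp.coeFn_toLp z.2
  · intro h
    have hm : MemLp (fun E : ℝ => (E : ℂ) * ψ E) 2 volume := (Lp.memLp θ).ae_eq h
    exact ⟨⟨ψ, hm⟩, rfl, Lp.ext ((MemLp.coeFn_toLp hm).trans h.symm)⟩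

theorem add_I_ne_zero (E : ℝ) : (E : ℂ) + I ≠ 0 := fun h => by
  simpa using congrArg Complex.im h

theorem memLp_inv_add_I : MemLp (fun E : ℝ => ((E : ℂ) + I)⁻¹) ∞ volume :=
  memLp_top_of_bound (Measurable.aestronglyMeasurable (by fun_prop)) 1 <| .of_forall fun E => by
    rw [norm_inv]
    apply inv_le_one_of_one_le₀
    simpa using Complex.abs_im_le_norm ((E : ℂ) + I)

/-- The resolvent `(H_W + i)⁻¹`, which shows that `H_W` is closed. -/
def weightResolvent : Weight →L[ℂ] Weight :=
  ContinuousLinearMap.holderL volume ∞ 2 2 (ContinuousLinearMap.mul ℂ ℂ)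
    (memLp_inv_add_I.toLp _)

theorem mem_graph_iff_weightResolvent {ψ θ : Weight} :
    (ψ, θ) ∈ weightHamiltonian.graph ↔ weightResolvent (θ + I • ψ) = ψ := by
  have hR : weightResolvent (θ + I • ψ) =ᵐ[volume] fun E => ((E : ℂ) + I)⁻¹ * (θ E + I * ψ E) := by
    filter_upwards [holderL_mul_apply_ae memLp_inv_add_I (θ + I • ψ), Lp.coeFn_add θ (I • ψ),
      Lp.coeFn_smul I ψ] with E hE hadd hsmul
    rw [weightResolvent, hE, hadd, Pi.add_apply, hsmul, Pi.smul_apply, smul_eq_mul]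
  rw [mem_graph_weightHamiltonian, Lp.ext_iff]
  refine Filter.eventually_congr ?_
  filter_upwards [hR] with E hE
  rw [hE, inv_mul_eq_iff_eq_mul₀ (add_I_ne_zero E), add_mul, add_left_inj]

theorem isClosed_weightHamiltonian : weightHamiltonian.IsClosed := by
  have h : (weightHamiltonian.graph : Set (Weight × Weight)) =
      {p | weightResolvent (p.2 + I • p.1) = p.1} :=
    Set.ext fun p => mem_graph_iff_weightResolvent
  rw [LinearPMap.IsClosed, h]
  exact isClosed_eq (by fun_prop) continuous_fst

variable {H : Type*} [NormedAddCommGroup H] [InnerProductSpace ℂ H] {T Y : H →L[ℂ] Weight}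

theorem IsComp.weightHamiltonian_apply_ae (h : IsComp weightHamiltonian T Y) (v : H) :
    Y v =ᵐ[volume] fun E => (E : ℂ) * T v E :=
  mem_graph_weightHamiltonian.1 (mem_graph_iff_exists.2 (h v))

theorem IsComp.displacement_comp (h : IsComp weightHamiltonian T Y) (e : ℝ) :
    IsComp weightHamiltonian (displacement e ∘L T) (displacement e ∘L (Y + (e : ℂ) • T)) := by
  refine fun v => mem_graph_iff_exists.1 (mem_graph_weightHamiltonian.2 ?_)
  filter_upwards [displacement_apply_ae e (T v), displacement_apply_ae e (Y v + (e : ℂ) • T v),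
    ae_comp_sub (h.weightHamiltonian_apply_ae v) e,
    ae_comp_sub (Lp.coeFn_add (Y v) ((e : ℂ) • T v)) e,
    ae_comp_sub (Lp.coeFn_smul (e : ℂ) (T v)) e] with E hT hY hmul hadd hsmul
  simp only [ContinuousLinearMap.comp_apply, _root_.add_apply, _root_.smul_apply]
  rw [hT, hY, hadd, Pi.add_apply, hsmul, hmul, Pi.smul_apply, smul_eq_mul]
  push_cast
  ring

end Weight

section Wave

section VectorValued

variable {α F : Type*} [MeasurableSpace α] {μ : Measure α}
  [NormedAddCommGroup F] [InnerProductSpace ℂ F]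

theorem toSpanSingleton_compLpL_apply_ae (v : F) (ψ : Lp ℂ 2 μ) :
    (ContinuousLinearMap.toSpanSingleton ℂ v).compLpL 2 μ ψ =ᵐ[μ] fun x => ψ x • v :=
  ContinuousLinearMap.coeFn_compLpL (p := 2) (μ := μ) _ ψ

/-- The embedding `ψ ↦ ψ(x) v` of scalar into vector-valued wave functions, for a unit
vector `v`. -/
def tensorVec (μ : Measure α) {v : F} (hv : ‖v‖ = 1) : Lp ℂ 2 μ →ₗᵢ[ℂ] Lp F 2 μ where
  toLinearMap := ((ContinuousLinearMap.toSpanSingleton ℂ v).compLpL 2 μ).toLinearMap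
  norm_map' ψ := by
    have h : ∀ᵐ x ∂μ, ‖(ContinuousLinearMap.toSpanSingleton ℂ v).compLpL 2 μ ψ x‖ = ‖ψ x‖ := by
      filter_upwards [toSpanSingleton_compLpL_apply_ae v ψ] with x hx
      rw [hx, norm_smul, hv, mul_one]
    exact congrArg ENNReal.toReal (eLpNorm_congr_norm_ae h)

theorem tensorVec_apply_ae {v : F} (hv : ‖v‖ = 1) (ψ : Lp ℂ 2 μ) :
    tensorVec μ hv ψ =ᵐ[μ] fun x => ψ x • v :=
  toSpanSingleton_compLpL_apply_ae v ψ

/-- The pairing `Φ ↦ ⟨v, Φ(x)⟩`. -/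
def pairVec (v : F) : Lp F 2 μ →L[ℂ] Lp ℂ 2 μ := (innerSL ℂ v).compLpL 2 μ

theorem pairVec_apply_ae (v : F) (Φ : Lp F 2 μ) : pairVec v Φ =ᵐ[μ] fun x => ⟪v, Φ x⟫_ℂ :=
  ContinuousLinearMap.coeFn_compLpL (p := 2) (μ := μ) _ Φ

theorem pairVec_tensorVec (v : F) {w : F} (hw : ‖w‖ = 1) (ψ : Lp ℂ 2 μ) :
    pairVec v (tensorVec μ hw ψ) = ⟪v, w⟫_ℂ • ψ := by
  apply Lp.ext
  filter_upwards [pairVec_apply_ae v (tensorVec μ hw ψ), tensorVec_apply_ae hw ψ,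
    Lp.coeFn_smul ⟪v, w⟫_ℂ ψ] with x h1 h2 h3
  rw [h1, h2, h3, inner_smul_right, Pi.smul_apply, smul_eq_mul, mul_comm]

theorem inner_tensorVec_left {v : F} (hv : ‖v‖ = 1) (ψ : Lp ℂ 2 μ) (Φ : Lp F 2 μ) :
    ⟪tensorVec μ hv ψ, Φ⟫_ℂ = ⟪ψ, pairVec v Φ⟫_ℂ := by
  rw [L2.inner_def, L2.inner_def]
  refine integral_congr_ae ?_
  filter_upwards [tensorVec_apply_ae hv ψ, pairVec_apply_ae v Φ] with x h1 h2
  rw [h1, h2, inner_smul_left, RCLike.inner_apply, mul_comm]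

theorem orthogonalFamily_tensorVec {κ : Type*} {e : κ → F} (he : Orthonormal ℂ e) :
    OrthogonalFamily ℂ (fun _ : κ => Lp ℂ 2 μ) fun k => tensorVec μ (he.1 k) := by
  intro k l hkl ψ φ
  rw [inner_tensorVec_left, pairVec_tensorVec, he.2 hkl, zero_smul, inner_zero_right]

end VectorValued

section HilbertSchmidt

variable {α H : Type*} [MeasurableSpace α] {μ : Measure α}
  [NormedAddCommGroup H] [InnerProductSpace ℂ H] [CompleteSpace H] {X Y : H →L[ℂ] Lp ℂ 2 μ}

/-- A Hilbert–Schmidt operator `X : H → L²(μ)` as the wave function `x ↦ ∑ₖ (X bₖ)(x) bₖ`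
in `L²(μ; H)`. -/
def wave (hX : IsHilbertSchmidt X) : Lp H 2 μ :=
  (orthogonalFamily_tensorVec (onb H).orthonormal).linearIsometry hX.vec

theorem inner_wave (hX : IsHilbertSchmidt X) (hY : IsHilbertSchmidt Y) :
    ⟪wave hX, wave hY⟫_ℂ = hsInner X Y :=
  (LinearIsometry.inner_map_map _ _ _).trans (hX.inner_vec hY)

theorem hasSum_pairVec_wave (hX : IsHilbertSchmidt X) (v : H) :
    HasSum (fun k => ⟪v, onb H k⟫_ℂ • X (onb H k)) (pairVec v (wave hX)) := by
  have h := (orthogonalFamily_tensorVec (μ := μ) (onb H).orthonormal).hasSum_linearIsometry hX.vec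
  simpa only [pairVec_tensorVec] using! (pairVec v).hasSum h

theorem pairVec_onb_wave (hX : IsHilbertSchmidt X) (k : basisIndex H) :
    pairVec (onb H k) (wave hX) = X (onb H k) := by
  have h := hasSum_single (f := fun l => ⟪onb H k, onb H l⟫_ℂ • X (onb H l)) k fun l hl => by
    rw [(onb H).orthonormal.2 hl.symm, zero_smul]
  rw [(hasSum_pairVec_wave hX (onb H k)).unique h, inner_self_eq_one_of_norm_eq_one
    ((onb H).orthonormal.1 k), one_smul]

theorem eq_of_forall_inner_onb_eq {v w : H} (h : ∀ k, ⟪onb H k, v⟫_ℂ = ⟪onb H k, w⟫_ℂ) :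
    v = w :=
  (onb H).repr.injective <| lp.ext <| funext fun k => by
    simpa only [HilbertBasis.repr_apply_apply] using h k

theorem inner_onb_wave_ae [Countable (basisIndex H)] (hX : IsHilbertSchmidt X) :
    ∀ᵐ x ∂μ, ∀ k, ⟪onb H k, wave hX x⟫_ℂ = X (onb H k) x := by
  refine ae_all_iff.2 fun k => ?_
  filter_upwards [pairVec_apply_ae (onb H k) (wave hX)] with x hx
  rw [← hx, pairVec_onb_wave]

end HilbertSchmidt

variable {H : Type*} [NormedAddCommGroup H] [InnerProductSpace ℂ H] [CompleteSpace H]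
  [Countable (basisIndex H)] {X Y : H →L[ℂ] Weight}

theorem wave_displacement_ae (hX : IsHilbertSchmidt X) (e : ℝ) :
    wave (hX.comp_left (displacement e)) =ᵐ[volume] fun x => wave hX (x - e) := by
  have h : ∀ᵐ x, ∀ k, displacement e (X (onb H k)) x = X (onb H k) (x - e) :=
    ae_all_iff.2 fun k => displacement_apply_ae e _
  filter_upwards [inner_onb_wave_ae (hX.comp_left (displacement e)),
    ae_comp_sub (inner_onb_wave_ae hX) e, h] with x h1 h2 h3
  refine eq_of_forall_inner_onb_eq fun k => ?_
  rw [h1, h2, ← h3, ContinuousLinearMap.comp_apply]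

theorem wave_eq_smul_ae {g : ℝ → ℂ} (hX : IsHilbertSchmidt X) (hY : IsHilbertSchmidt Y)
    (h : ∀ v, Y v =ᵐ[volume] fun x => g x * X v x) :
    wave hY =ᵐ[volume] fun x => g x • wave hX x := by
  have h : ∀ᵐ x, ∀ k, Y (onb H k) x = g x * X (onb H k) x := ae_all_iff.2 fun k => h _
  filter_upwards [inner_onb_wave_ae hX, inner_onb_wave_ae hY, h] with x h1 h2 h3
  refine eq_of_forall_inner_onb_eq fun k => ?_
  rw [h2, h3, inner_smul_right, h1]

theorem wave_exp_ae (hX : IsHilbertSchmidt X) (s : ℝ) :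
    wave (hX.comp_left (expWeightHamiltonian s)) =ᵐ[volume]
      fun x => cexp (I * x * s) • wave hX x :=
  wave_eq_smul_ae hX _ fun v => expWeightHamiltonian_apply_ae s (X v)

theorem wave_weightHamiltonian_ae (hX : IsHilbertSchmidt X) (hY : IsHilbertSchmidt Y)
    (h : IsComp weightHamiltonian X Y) : wave hY =ᵐ[volume] fun x => (x : ℂ) • wave hX x :=
  wave_eq_smul_ae hX hY h.weightHamiltonian_apply_ae

theorem integrable_wave (hX : IsHilbertSchmidt X) (hY : IsHilbertSchmidt Y)
    (h : IsComp weightHamiltonian X Y) : Integrable (wave hX) := by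
  have hinv : MemLp (fun x : ℝ => ((x : ℂ) + I)⁻¹) 2 := by
    rw [memLp_two_iff_integrable_sq_norm memLp_inv_add_I.1]
    refine integrable_inv_one_add_sq.congr <| .of_forall fun x => ?_
    change (1 + x ^ 2)⁻¹ = ‖((x : ℂ) + I)⁻¹‖ ^ 2
    rw [norm_inv, inv_pow, ← Complex.normSq_eq_norm_sq, ← one_mul I, ← ofReal_one,
      Complex.normSq_add_mul_I, one_pow, add_comm]
  have hsum : MemLp (fun x => wave hY x + I • wave hX x) 2 :=
    (Lp.memLp (wave hY)).add ((Lp.memLp (wave hX)).const_smul I)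
  refine (memLp_one_iff_integrable.1 (hsum.smul hinv (r := 1))).congr ?_
  filter_upwards [wave_weightHamiltonian_ae hX hY h] with x hx
  rw [Pi.smul_apply', hx, ← add_smul, smul_smul, inv_mul_cancel₀ (add_I_ne_zero x), one_smul]

end Wave

section Kernel

open ContinuousLinearMap (adjoint)

theorem ae_eq_prod_of_ae_ae_eq {α β E : Type*} [MeasurableSpace α] [MeasurableSpace β]
    {μ : Measure α} {ν : Measure β} [SFinite ν] [TopologicalSpace E]
    [TopologicalSpace.MetrizableSpace E] {f g : α × β → E}
    (hf : AEStronglyMeasurable f (μ.prod ν)) (hg : AEStronglyMeasurable g (μ.prod ν))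
    (h : ∀ᵐ x ∂μ, ∀ᵐ y ∂ν, f (x, y) = g (x, y)) : f =ᵐ[μ.prod ν] g := by
  suffices hmk : hf.mk f =ᵐ[μ.prod ν] hg.mk g from hf.ae_eq_mk.trans (hmk.trans hg.ae_eq_mk.symm)
  refine (Measure.ae_prod_iff_ae_ae
    (hf.stronglyMeasurable_mk.measurableSet_eq_fun hg.stronglyMeasurable_mk)).2 ?_
  filter_upwards [h, Measure.ae_ae_of_ae_prod hf.ae_eq_mk,
    Measure.ae_ae_of_ae_prod hg.ae_eq_mk] with x hx hfx hgx
  filter_upwards [hx, hfx, hgx] with y hy hfy hgy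
  rw [← hfy, hy, hgy]

theorem ae_eq_of_integral_mul_eq_of_dense {α : Type*} [MeasurableSpace α] {μ : Measure α}
    {S : Set (Lp ℂ 2 μ)} (hS : Dense S) {f g : α → ℂ} (hf : MemLp f 2 μ) (hg : MemLp g 2 μ)
    (h : ∀ φ ∈ S, ∫ x, f x * φ x ∂μ = ∫ x, g x * φ x ∂μ) : f =ᵐ[μ] g := by
  have hinner {f : α → ℂ} (hf : MemLp f 2 μ) (φ : Lp ℂ 2 μ) :
      ⟪hf.star.toLp (star f), φ⟫_ℂ = ∫ x, f x * φ x ∂μ := by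
    rw [L2.inner_def]
    refine integral_congr_ae ?_
    filter_upwards [hf.star.coeFn_toLp] with x hx
    rw [hx, Pi.star_apply, RCLike.inner_apply, ← starRingEnd_apply, starRingEnd_self_apply,
      mul_comm]
  have heq : hf.star.toLp (star f) = hg.star.toLp (star g) :=
    hS.eq_of_inner_left ℂ fun φ hφ => by rw [hinner hf, hinner hg, h φ hφ]
  filter_upwards [(MemLp.toLp_eq_toLp_iff hf.star hg.star).1 heq] with x hx
  exact star_injective hx

theorem memLp_two_prodMk_left_ae {α β E : Type*} [MeasurableSpace α] [MeasurableSpace β]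
    {μ : Measure α} {ν : Measure β} [SFinite μ] [SFinite ν] [NormedAddCommGroup E]
    {f : α × β → E} (hf : MemLp f 2 (μ.prod ν)) :
    ∀ᵐ x ∂μ, MemLp (fun y => f (x, y)) 2 ν := by
  filter_upwards [(hf.integrable_norm_pow two_ne_zero).prod_right_ae, hf.1.prodMk_left]
    with x hx hmeas
  exact (memLp_two_iff_integrable_sq_norm hmeas).2 hx

variable {ρ : Weight →L[ℂ] Weight}

theorem IsKernel.ae_eq {K L : ℝ → ℝ → ℂ} (hK : IsKernel ρ K) (hL : IsKernel ρ L) :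
    ∀ᵐ p : ℝ × ℝ, K p.1 p.2 = L p.1 p.2 := by
  have hd : ∀ᵐ x, ∀ n, ∫ y, K x y * TopologicalSpace.denseSeq Weight n y =
      ∫ y, L x y * TopologicalSpace.denseSeq Weight n y :=
    ae_all_iff.2 fun n => (hK.apply_ae _).symm.trans (hL.apply_ae _)
  refine ae_eq_prod_of_ae_ae_eq hK.memLp.1 hL.memLp.1 ?_
  filter_upwards [memLp_two_prodMk_left_ae hK.memLp, memLp_two_prodMk_left_ae hL.memLp, hd]
    with x hKx hLx hx
  exact ae_eq_of_integral_mul_eq_of_dense (TopologicalSpace.denseRange_denseSeq Weight) hKx hLx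
    (Set.forall_mem_range.2 hx)

variable {H : Type*} [NormedAddCommGroup H] [InnerProductSpace ℂ H] [CompleteSpace H]
  {X Y : H →L[ℂ] Weight}

theorem memLp_inner_prod {F : Type*} [NormedAddCommGroup F] [InnerProductSpace ℂ F]
    {f g : ℝ → F} (hf : MemLp f 2) (hg : MemLp g 2) :
    MemLp (fun p : ℝ × ℝ => ⟪g p.2, f p.1⟫_ℂ) 2 := by
  have hm : AEStronglyMeasurable (fun p : ℝ × ℝ => ⟪g p.2, f p.1⟫_ℂ)
      ((volume : Measure ℝ).prod volume) := hg.1.comp_snd.inner hf.1.comp_fst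
  have hf2 := (memLp_two_iff_integrable_sq_norm hf.1).1 hf
  have hg2 := (memLp_two_iff_integrable_sq_norm hg.1).1 hg
  refine (memLp_two_iff_integrable_sq_norm hm).2 <|
    (hf2.mul_prod hg2).mono' (hm.norm.pow 2) <| .of_forall fun p => ?_
  rw [norm_pow, norm_norm, ← mul_pow, mul_comm]
  gcongr
  exact norm_inner_le_norm _ _

theorem inner_integral_wave_onb (hY : IsHilbertSchmidt Y) (ψ : Weight) (k : basisIndex H) :
    ⟪∫ y, starRingEnd ℂ (ψ y) • wave hY y, onb H k⟫_ℂ = ⟪Y (onb H k), ψ⟫_ℂ := by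
  have hinteg : Integrable fun y => starRingEnd ℂ (ψ y) • wave hY y :=
    memLp_one_iff_integrable.1 ((Lp.memLp (wave hY)).smul (Lp.memLp ψ).star (r := 1))
  rw [← inner_conj_symm, ← integral_inner hinteg, ← inner_conj_symm (Y _), ← pairVec_onb_wave hY,
    L2.inner_def]
  congr 1
  refine integral_congr_ae ?_
  filter_upwards [pairVec_apply_ae (onb H k) (wave hY)] with y hy
  rw [hy, inner_smul_right, RCLike.inner_apply, mul_comm]

theorem isKernel_comp_adjoint (hX : IsHilbertSchmidt X) (hY : IsHilbertSchmidt Y) :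
    IsKernel (X ∘L adjoint Y) fun x y => ⟪wave hY y, wave hX x⟫_ℂ where
  memLp := memLp_inner_prod (Lp.memLp (wave hX)) (Lp.memLp (wave hY))
  apply_ae ψ := by
    have hinteg : Integrable fun y => starRingEnd ℂ (ψ y) • wave hY y :=
      memLp_one_iff_integrable.1 ((Lp.memLp (wave hY)).smul (Lp.memLp ψ).star (r := 1))
    set v := ∫ y, starRingEnd ℂ (ψ y) • wave hY y with hv
    have hXY : (X ∘L adjoint Y) ψ = pairVec v (wave hX) := by
      refine HasSum.unique ?_ (hasSum_pairVec_wave hX v)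
      rw [ContinuousLinearMap.comp_apply]
      simpa only [hv, inner_integral_wave_onb, ContinuousLinearMap.adjoint_inner_right] using
        hasSum_inner_smul_apply X (adjoint Y ψ)
    rw [hXY]
    filter_upwards [pairVec_apply_ae v (wave hX)] with x hx
    rw [hx, ← inner_conj_symm, hv, ← integral_inner hinteg, ← integral_conj]
    refine integral_congr_ae <| .of_forall fun y => ?_
    simp only [inner_smul_right, map_mul, starRingEnd_self_apply, inner_conj_symm]
    ring

theorem IsDensityOperator.isKernel_wave (hρ : IsDensityOperator ρ) :
    IsKernel ρ fun x y =>
      ⟪wave hρ.isHilbertSchmidt_sqrtOp y, wave hρ.isHilbertSchmidt_sqrtOp x⟫_ℂ := by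
  have h := isKernel_comp_adjoint hρ.isHilbertSchmidt_sqrtOp hρ.isHilbertSchmidt_sqrtOp
  rwa [adjoint_sqrtOp, sqrtOp_comp_self hρ.isPositive] at h

theorem IsDensityOperator.kernel_ae_eq (hρ : IsDensityOperator ρ) :
    ∀ᵐ p : ℝ × ℝ, kernel ρ p.1 p.2 =
      ⟪wave hρ.isHilbertSchmidt_sqrtOp p.2, wave hρ.isHilbertSchmidt_sqrtOp p.1⟫_ℂ :=
  (Classical.epsilon_spec ⟨_, hρ.isKernel_wave⟩ : IsKernel ρ (kernel ρ)).ae_eq hρ.isKernel_wave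

end Kernel

section Fourier

open FourierTransform SchwartzMap

variable {F : Type*} [NormedAddCommGroup F] [InnerProductSpace ℂ F]

/-- The amplitude in the time representation, `f̂(t) = ∫ dE e^{-itE} f(E)`: the Fourier transform
without the factor `2π` in the exponent. -/
def timeAmplitude (f : ℝ → F) (t : ℝ) : F := ∫ x : ℝ, cexp (-(I * t * x)) • f x

theorem fourier_eq_timeAmplitude (f : ℝ → F) (τ : ℝ) :
    𝓕 f τ = timeAmplitude f (2 * Real.pi * τ) := by
  rw [Real.fourier_real_eq_integral_exp_smul, timeAmplitude]
  refine integral_congr_ae <| .of_forall fun x => ?_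
  beta_reduce
  congr 2
  push_cast
  ring

theorem timeAmplitude_exp_smul (f : ℝ → F) (a t : ℝ) :
    timeAmplitude (fun x => cexp (I * a * x) • f x) t = timeAmplitude f (t - a) := by
  refine integral_congr_ae <| .of_forall fun x => ?_
  beta_reduce
  rw [smul_smul, ← Complex.exp_add]
  congr 2
  push_cast
  ring

theorem timeAmplitude_comp_sub_right (f : ℝ → F) (e t : ℝ) :
    timeAmplitude (fun x => f (x - e)) t = cexp (-(I * t * e)) • timeAmplitude f t := by
  rw [timeAmplitude, timeAmplitude, ← integral_smul,
    ← integral_sub_right_eq_self (fun x : ℝ => cexp (-(I * t * e)) • cexp (-(I * t * x)) • f x) e]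
  refine integral_congr_ae <| .of_forall fun x => ?_
  beta_reduce
  rw [smul_smul, ← Complex.exp_add]
  congr 2
  push_cast
  ring

theorem norm_cexp_I_mul (t x : ℝ) : ‖cexp (I * t * x)‖ = 1 := by
  rw [show I * t * x = ((t * x : ℝ) : ℂ) * I by push_cast; ring, norm_exp_ofReal_mul_I]

theorem integrable_exp_smul {f : ℝ → F} (hf : Integrable f) (a : ℝ) :
    Integrable fun x : ℝ => cexp (I * a * x) • f x :=
  hf.bdd_smul 1 (by fun_prop) <| .of_forall fun x => (norm_cexp_I_mul a x).le

theorem memLp_exp_smul {p : ℝ≥0∞} {f : ℝ → F} (hf : MemLp f p) (a : ℝ) :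
    MemLp (fun x : ℝ => cexp (I * a * x) • f x) p :=
  hf.of_le (AEStronglyMeasurable.smul (by fun_prop) hf.1) <| .of_forall fun x => by
    rw [norm_smul, norm_cexp_I_mul, one_mul]

open scoped ContDiff in
theorem fourier_toLp_ae [CompleteSpace F] {f : ℝ → F} (hf : Integrable f) (hf2 : MemLp f 2) :
    (𝓕 (hf2.toLp f) : Lp F 2 (volume : Measure ℝ)) =ᵐ[volume] 𝓕 f := by
  have hcont : Continuous (𝓕 f) :=
    VectorFourier.fourierIntegral_continuous Real.continuous_fourierChar (by fun_prop) hf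
  refine ae_eq_of_integral_contDiff_smul_eq
    ((Lp.memLp (𝓕 (hf2.toLp f))).locallyIntegrable (by norm_num)) hcont.locallyIntegrable
    fun g hg hgc => ?_
  have hg₁ : HasCompactSupport (Complex.ofRealCLM ∘ g) := hgc.comp_left rfl
  have hg₂ : ContDiff ℝ ∞ (Complex.ofRealCLM ∘ g) := by fun_prop
  set G : 𝓢(ℝ, ℂ) := hg₁.toSchwartzMap hg₂
  have hdistribution := congrArg (fun T : TemperedDistribution ℝ F => T G)
    (Lp.fourier_toTemperedDistribution_eq (hf2.toLp f))
  simp only [TemperedDistribution.fourier_apply, Lp.toTemperedDistribution_apply] at hdistribution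
  calc ∫ x, G x • (𝓕 (hf2.toLp f) : Lp F 2 (volume : Measure ℝ)) x
      = ∫ x, (𝓕 G : 𝓢(ℝ, ℂ)) x • hf2.toLp f x := hdistribution.symm
    _ = ∫ x, 𝓕 (G : ℝ → ℂ) x • f x := integral_congr_ae <| by
      filter_upwards [hf2.coeFn_toLp] with x hx
      rw [hx, SchwartzMap.fourier_coe]
    _ = ∫ x, G x • 𝓕 f x := by
      refine (VectorFourier.integral_fourierIntegral_smul_eq_flip (L := innerₗ ℝ)
        Real.continuous_fourierChar (by fun_prop) G.integrable hf).trans ?_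
      simp only [Real.fourier_eq, VectorFourier.fourierIntegral, LinearMap.flip_apply,
        innerₗ_apply_apply, real_inner_comm]

theorem integral_inner_fourier_fourier [CompleteSpace F] {f g : ℝ → F} (hf : Integrable f)
    (hf2 : MemLp f 2) (hg : Integrable g) (hg2 : MemLp g 2) :
    ∫ x, ⟪𝓕 f x, 𝓕 g x⟫_ℂ = ∫ x, ⟪f x, g x⟫_ℂ := by
  have h := Lp.inner_fourier_eq (hf2.toLp f) (hg2.toLp g)
  rw [L2.inner_def, L2.inner_def] at h
  refine (integral_congr_ae ?_).trans (h.trans (integral_congr_ae ?_))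
  · filter_upwards [fourier_toLp_ae hf hf2, fourier_toLp_ae hg hg2] with x hfx hgx
    rw [hfx, hgx]
  · filter_upwards [hf2.coeFn_toLp, hg2.coeFn_toLp] with x hfx hgx
    rw [hfx, hgx]

theorem integral_inner_timeAmplitude [CompleteSpace F] {f g : ℝ → F} (hf : Integrable f)
    (hf2 : MemLp f 2) (hg : Integrable g) (hg2 : MemLp g 2) :
    ∫ t, ⟪timeAmplitude f t, timeAmplitude g t⟫_ℂ = 2 * Real.pi * ∫ x, ⟪f x, g x⟫_ℂ := by
  have h := Measure.integral_comp_mul_left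
    (fun t => ⟪timeAmplitude f t, timeAmplitude g t⟫_ℂ) (2 * Real.pi)
  rw [abs_of_pos (by positivity), eq_inv_smul_iff₀ (by positivity)] at h
  rw [← h, ← integral_inner_fourier_fourier hf hf2 hg hg2, Complex.real_smul]
  simp only [fourier_eq_timeAmplitude, ofReal_mul, ofReal_ofNat]

theorem measurePreserving_midpoint :
    MeasurePreserving (fun p : ℝ × ℝ => (p.1 - p.2 / 2, p.1 + p.2 / 2)) := by
  have hleft : MeasurePreserving (fun p : ℝ × ℝ => (p.1, p.2 - p.1 / 2)) :=
    MeasurePreserving.skew_product (g := fun x y : ℝ => y - x / 2) (MeasurePreserving.id _)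
      (by fun_prop) <| .of_forall fun x => (measurePreserving_sub_right volume (x / 2)).map_eq
  have hright : MeasurePreserving (fun p : ℝ × ℝ => (p.1, p.2 + p.1)) :=
    MeasurePreserving.skew_product (g := fun x y : ℝ => y + x) (MeasurePreserving.id _)
      (by fun_prop) <| .of_forall fun x => (measurePreserving_add_right volume x).map_eq
  have hswap : MeasurePreserving (Prod.swap : ℝ × ℝ → ℝ × ℝ) := Measure.measurePreserving_swap
  convert hright.comp (hswap.comp (hleft.comp hswap)) using 1
  ext p
  · rfl
  · exact (by ring : p.1 + p.2 / 2 = p.2 + (p.1 - p.2 / 2))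

theorem inner_integral_integral_midpoint [CompleteSpace F] {f g : ℝ → F} (hf : Integrable f)
    (hg : Integrable g) :
    ⟪∫ x, f x, ∫ y, g y⟫_ℂ = ∫ E : ℝ, ∫ ω : ℝ, ⟪f (E + ω / 2), g (E - ω / 2)⟫_ℂ := by
  have hmid := measurePreserving_midpoint
  have hinteg : Integrable fun p : ℝ × ℝ => ⟪f p.2, g p.1⟫_ℂ :=
    (hg.norm.mul_prod hf.norm).mono' (hf.1.comp_snd.inner hg.1.comp_fst) <| .of_forall fun p =>
      (norm_inner_le_norm _ _).trans_eq (mul_comm _ _)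
  have hmeas := hinteg.1
  rw [← hmid.map_eq] at hmeas
  calc ⟪∫ x, f x, ∫ y, g y⟫_ℂ
      = ∫ y, ∫ x, ⟪f x, g y⟫_ℂ := by
        rw [← integral_inner hg]
        refine integral_congr_ae <| .of_forall fun y => ?_
        beta_reduce
        rw [← inner_conj_symm, ← integral_inner hf, ← integral_conj]
        simp only [inner_conj_symm]
    _ = ∫ p : ℝ × ℝ, ⟪f p.2, g p.1⟫_ℂ := (integral_prod _ hinteg).symm
    _ = ∫ p : ℝ × ℝ, ⟪f (p.1 + p.2 / 2), g (p.1 - p.2 / 2)⟫_ℂ := by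
        rw [← integral_map hmid.measurable.aemeasurable hmeas, hmid.map_eq]
    _ = _ := integral_prod _ ((hmid.integrable_comp hinteg.1).2 hinteg)

theorem integral_exp_mul_wigner [CompleteSpace F] {ρ : Weight →L[ℂ] Weight} {Φ : ℝ → F}
    (hΦ : Integrable Φ) (hK : ∀ᵐ p : ℝ × ℝ, kernel ρ p.1 p.2 = ⟪Φ p.2, Φ p.1⟫_ℂ) (s t : ℝ) :
    ∫ E : ℝ, cexp (I * E * s) * wigner ρ E t =
      1 / (2 * Real.pi) * ⟪timeAmplitude Φ (t + s / 2), timeAmplitude Φ (t - s / 2)⟫_ℂ := by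
  have hinteg (u : ℝ) : Integrable fun x : ℝ => cexp (-(I * u * x)) • Φ x := by
    simpa only [ofReal_neg, mul_neg, neg_mul] using integrable_exp_smul hΦ (-u)
  rw [timeAmplitude, timeAmplitude, inner_integral_integral_midpoint (hinteg _) (hinteg _),
    ← integral_const_mul]
  refine integral_congr_ae ?_
  filter_upwards [Measure.ae_ae_of_ae_prod
    (measurePreserving_midpoint.quasiMeasurePreserving.ae hK)] with E hE
  rw [wigner, mul_left_comm, ← integral_const_mul]
  congr 1
  refine integral_congr_ae ?_
  filter_upwards [hE] with ω hω
  rw [hω, inner_smul_left, inner_smul_right, ← mul_assoc, ← mul_assoc, ← Complex.exp_conj,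
    ← Complex.exp_add, ← Complex.exp_add]
  congr 2
  simp only [map_neg, map_mul, Complex.conj_I, Complex.conj_ofReal]
  push_cast
  ring

theorem integral_inner_timeAmplitude_shifted [CompleteSpace F] {Φ : ℝ → F} (hΦ : Integrable Φ)
    (hΦ2 : MemLp Φ 2) (s ω : ℝ) :
    ∫ t : ℝ, ⟪timeAmplitude Φ (t + s / 2), timeAmplitude Φ (t - s / 2)⟫_ℂ * cexp (-(I * t * ω)) =
      2 * Real.pi * (cexp (-(I * ω * s / 2)) * ∫ x : ℝ, cexp (I * x * s) * ⟪Φ x, Φ (x - ω)⟫_ℂ) := by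
  set f := fun x : ℝ => cexp (I * (-(s / 2) : ℝ) * x) • Φ x
  set g := fun x : ℝ => cexp (I * (s / 2 : ℝ) * x) • Φ x
  have hamplitude (t : ℝ) : ⟪timeAmplitude f t, timeAmplitude (fun x => g (x - ω)) t⟫_ℂ =
      ⟪timeAmplitude Φ (t + s / 2), timeAmplitude Φ (t - s / 2)⟫_ℂ * cexp (-(I * t * ω)) := by
    rw [timeAmplitude_comp_sub_right, inner_smul_right, timeAmplitude_exp_smul,
      timeAmplitude_exp_smul, sub_neg_eq_add, mul_comm]
  have hphase (x : ℝ) :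
      ⟪f x, g (x - ω)⟫_ℂ = cexp (-(I * ω * s / 2)) * (cexp (I * x * s) * ⟪Φ x, Φ (x - ω)⟫_ℂ) := by
    rw [inner_smul_left, inner_smul_right, ← mul_assoc, ← mul_assoc, ← Complex.exp_conj,
      ← Complex.exp_add, ← Complex.exp_add]
    congr 2
    simp only [map_mul, Complex.conj_I, Complex.conj_ofReal]
    push_cast
    ring
  simp only [← hamplitude]
  rw [integral_inner_timeAmplitude (integrable_exp_smul hΦ _) (memLp_exp_smul hΦ2 _)
    ((integrable_exp_smul hΦ _).comp_sub_right ω)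
    ((memLp_exp_smul hΦ2 _).comp_measurePreserving (measurePreserving_sub_right volume ω)),
    ← integral_const_mul (cexp _)]
  exact congrArg _ (integral_congr_ae (.of_forall hphase))

end Fourier

section Joint

open ContinuousLinearMap (adjoint)

variable {ι : Type*}

theorem comp_apply (i : ι) (Ψ : Joint ι) : comp i Ψ = Ψ i := rfl

section JointWeightHamiltonian

variable [Fintype ι] {H : Type*} [NormedAddCommGroup H] [InnerProductSpace ℂ H]

theorem isComp_jointWeightHamiltonian_iff {X Z : H →L[ℂ] Joint ι} :
    IsComp jointWeightHamiltonian X Z ↔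
      ∀ i, IsComp weightHamiltonian (comp i ∘L X) (comp i ∘L Z) :=
  ⟨fun h i x => ⟨(h x).1 i, congrArg (fun Ψ : Joint ι => Ψ i) (h x).2⟩,
    fun h x => ⟨fun i => (h i x).1, PiLp.ext fun i => (h i x).2⟩⟩

end JointWeightHamiltonian

theorem exists_posSemidef_sqrt [Fintype ι] {A : Matrix ι ι ℂ} (hA : A.PosSemidef) :
    ∃ B : Matrix ι ι ℂ, B.PosSemidef ∧ B * B = A := by
  classical
  open scoped MatrixOrder Matrix.Norms.L2Operator in
  exact ⟨CFC.sqrt A, Matrix.nonneg_iff_posSemidef.1 (CFC.sqrt_nonneg A),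
    CFC.sqrt_mul_sqrt_self A (Matrix.nonneg_iff_posSemidef.2 hA)⟩

variable [DecidableEq ι]

theorem incl_apply (j i : ι) (ψ : Weight) : incl j ψ i = if i = j then ψ else 0 :=
  Pi.single_apply j ψ i

variable [Fintype ι]

theorem adjoint_incl (j : ι) : adjoint (incl j) = comp j := by
  refine ContinuousLinearMap.ext fun Ψ => ext_inner_left ℂ fun ψ => ?_
  rw [ContinuousLinearMap.adjoint_inner_right, PiLp.inner_apply,
    Finset.sum_eq_single j (fun i _ hi => by rw [incl_apply, if_neg hi, inner_zero_left]) (by simp),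
    incl_apply, if_pos rfl, comp_apply]

theorem adjoint_comp (j : ι) : adjoint (comp j) = incl j := by
  rw [← adjoint_incl, ContinuousLinearMap.adjoint_adjoint]

theorem tensorOp_apply (A : Matrix ι ι ℂ) (B : Weight →L[ℂ] Weight) (Ψ : Joint ι) (i : ι) :
    tensorOp A B Ψ i = ∑ j, A i j • B (Ψ j) := by
  simp only [tensorOp, sum_apply, smul_apply, ContinuousLinearMap.comp_apply, comp_apply,
    WithLp.ofLp_sum, WithLp.ofLp_smul, Finset.sum_apply, Pi.smul_apply, incl_apply, smul_ite,
    smul_zero]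
  rw [Finset.sum_comm]
  simp only [Finset.sum_ite_eq, Finset.mem_univ, if_true]

theorem comp_comp_tensorOp (A : Matrix ι ι ℂ) (B : Weight →L[ℂ] Weight) (i : ι) :
    comp i ∘L tensorOp A B = ∑ j, A i j • (B ∘L comp j) := by
  ext1 Ψ
  simp only [ContinuousLinearMap.comp_apply, comp_apply, tensorOp_apply, sum_apply, smul_apply]

theorem comp_tensorOp_incl (A : Matrix ι ι ℂ) (B : Weight →L[ℂ] Weight) (i j : ι) :
    comp i ∘L tensorOp A B ∘L incl j = A i j • B := by
  ext1 ψ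
  simp only [ContinuousLinearMap.comp_apply, comp_apply, tensorOp_apply, incl_apply, smul_apply,
    apply_ite B, map_zero, smul_ite, smul_zero, Finset.sum_ite_eq', Finset.mem_univ, if_true]

theorem tensorOp_comp (A C : Matrix ι ι ℂ) (B D : Weight →L[ℂ] Weight) :
    tensorOp A B ∘L tensorOp C D = tensorOp (A * C) (B ∘L D) := by
  ext1 Ψ
  ext1 i
  simp only [ContinuousLinearMap.comp_apply, tensorOp_apply, map_sum, map_smul, Matrix.mul_apply,
    Finset.sum_smul, Finset.smul_sum, smul_smul]
  exact Finset.sum_comm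

theorem adjoint_tensorOp (A : Matrix ι ι ℂ) (B : Weight →L[ℂ] Weight) :
    adjoint (tensorOp A B) = tensorOp A.conjTranspose (adjoint B) := by
  simp only [tensorOp, map_sum, map_smulₛₗ, ContinuousLinearMap.adjoint_comp, adjoint_incl,
    adjoint_comp, ContinuousLinearMap.comp_assoc]
  exact Finset.sum_comm

theorem tensorOp_one_id :
    tensorOp (1 : Matrix ι ι ℂ) (.id ℂ Weight) = .id ℂ (Joint ι) := by
  ext1 Ψ
  ext1 i
  simp only [tensorOp_apply, Matrix.one_apply, ContinuousLinearMap.id_apply, ite_smul, one_smul,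
    zero_smul, Finset.sum_ite_eq, Finset.mem_univ, if_true]

theorem IsHilbertSchmidt.tensorOp {B : Weight →L[ℂ] Weight} (hB : IsHilbertSchmidt B)
    (A : Matrix ι ι ℂ) : IsHilbertSchmidt (tensorOp A B) :=
  IsHilbertSchmidt.sum fun i _ => IsHilbertSchmidt.sum fun j _ =>
    ((hB.comp_right (comp j)).comp_left (incl i)).smul _

theorem hsInner_tensorOp (A C : Matrix ι ι ℂ) {B D : Weight →L[ℂ] Weight}
    (hB : IsHilbertSchmidt B) (hD : IsHilbertSchmidt D) :
    hsInner (tensorOp A B) (tensorOp C D) = (A.conjTranspose * C).trace * hsInner B D := by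
  have hterm (i j : ι) : IsHilbertSchmidt (C i j • (incl i ∘L D ∘L comp j)) :=
    ((hD.comp_right (comp j)).comp_left (incl i)).smul _
  have hentry (i j : ι) : hsInner (tensorOp A B) (C i j • (incl i ∘L D ∘L comp j)) =
      starRingEnd ℂ (A i j) * C i j * hsInner B D := by
    rw [hsInner_smul_right, ← adjoint_comp i, ← hsInner_comp_left, ← adjoint_incl j,
      ← hsInner_comp_right ((hB.tensorOp A).comp_left _) hD, ContinuousLinearMap.comp_assoc,
      comp_tensorOp_incl, hsInner_smul_left]
    ring
  rw [tensorOp.eq_1 C D, hsInner_sum_right _ (hB.tensorOp A) fun i => .sum fun j _ => hterm i j]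
  simp only [hsInner_sum_right _ (hB.tensorOp A) (hterm _), hentry, ← Finset.sum_mul]
  rw [Finset.sum_comm]
  rfl

theorem isPositive_tensorOp {A : Matrix ι ι ℂ} {B : Weight →L[ℂ] Weight} (hA : A.PosSemidef)
    (hB : B.IsPositive) : (tensorOp A B).IsPositive := by
  obtain ⟨C, hC, rfl⟩ := exists_posSemidef_sqrt hA
  have hself : adjoint (tensorOp C (sqrtOp B)) = tensorOp C (sqrtOp B) := by
    rw [adjoint_tensorOp, hC.1.eq, adjoint_sqrtOp]
  have h := ContinuousLinearMap.isPositive_adjoint_comp_self (tensorOp C (sqrtOp B))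
  rwa [hself, tensorOp_comp, sqrtOp_comp_self hB] at h

theorem sqrtOp_tensorOp {A : Matrix ι ι ℂ} {B : Weight →L[ℂ] Weight} (hA : A.PosSemidef)
    (hB : B.IsPositive) : sqrtOp (tensorOp (A * A) B) = tensorOp A (sqrtOp B) :=
  sqrtOp_eq_of_comp_self (by rw [tensorOp_comp, sqrtOp_comp_self hB])
    (isPositive_tensorOp hA (isPositive_sqrtOp B))

theorem IsComp.tensorOp {T Y : Weight →L[ℂ] Weight} (h : IsComp weightHamiltonian T Y)
    (A : Matrix ι ι ℂ) : IsComp jointWeightHamiltonian (tensorOp A T) (tensorOp A Y) :=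
  isComp_jointWeightHamiltonian_iff.2 fun i => by
    simp only [comp_comp_tensorOp]
    exact .sum fun j => (h.comp_right (comp j)).smul (A i j)

end Joint

section WorkUnitary

open ContinuousLinearMap (adjoint)

variable {ι : Type*} [Fintype ι] [DecidableEq ι]

theorem shiftOp_apply (ε : ι → ℝ) (Ψ : Joint ι) (i : ι) :
    shiftOp ε Ψ i = displacement (ε i) (Ψ i) := by
  simp only [shiftOp, sum_apply, WithLp.ofLp_sum, Finset.sum_apply, tensorOp_apply,
    Matrix.single_apply, ite_and, ite_smul, one_smul, zero_smul, Finset.sum_ite_irrel,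
    Finset.sum_const_zero, Finset.sum_ite_eq, Finset.mem_univ, if_true, Finset.sum_ite_eq']

theorem comp_shiftOp (ε : ι → ℝ) (i : ι) :
    comp i ∘L shiftOp ε = displacement (ε i) ∘L comp i :=
  ContinuousLinearMap.ext fun Ψ => shiftOp_apply ε Ψ i

theorem adjoint_shiftOp (ε : ι → ℝ) : adjoint (shiftOp ε) = shiftOp (-ε) := by
  simp only [shiftOp, map_sum, adjoint_tensorOp, Matrix.conjTranspose_single, star_one,
    adjoint_displacement, Pi.neg_apply]

theorem shiftOp_comp_shiftOp_neg (ε : ι → ℝ) : shiftOp ε ∘L shiftOp (-ε) = .id ℂ (Joint ι) := by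
  ext1 Ψ
  ext1 i
  rw [ContinuousLinearMap.comp_apply, shiftOp_apply, shiftOp_apply,
    ← ContinuousLinearMap.comp_apply, displacement_comp, Pi.neg_apply, add_neg_cancel,
    displacement_zero]
  rfl

theorem shiftOp_comp_adjoint (ε : ι → ℝ) :
    shiftOp ε ∘L adjoint (shiftOp ε) = .id ℂ (Joint ι) := by
  rw [adjoint_shiftOp, shiftOp_comp_shiftOp_neg]

theorem adjoint_shiftOp_comp (ε : ι → ℝ) :
    adjoint (shiftOp ε) ∘L shiftOp ε = .id ℂ (Joint ι) := by
  simpa only [adjoint_shiftOp, neg_neg] using shiftOp_comp_shiftOp_neg (-ε)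

theorem comp_jointSystemOp_systemHamiltonian (ε : ι → ℝ) (i : ι) :
    comp i ∘L jointSystemOp (systemHamiltonian ε) = (ε i : ℂ) • comp i := by
  simp only [jointSystemOp, comp_comp_tensorOp, ContinuousLinearMap.id_comp, systemHamiltonian,
    Matrix.diagonal_apply, ite_smul, zero_smul, Finset.sum_ite_eq, Finset.mem_univ, if_true]

theorem jointSystemOp_systemHamiltonian_comp_shiftOp (ε : ι → ℝ) :
    jointSystemOp (systemHamiltonian ε) ∘L shiftOp ε =
      shiftOp ε ∘L jointSystemOp (systemHamiltonian ε) := by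
  refine ContinuousLinearMap.ext fun Ψ => PiLp.ext fun i => ?_
  have h (Φ : Joint ι) : jointSystemOp (systemHamiltonian ε) Φ i = (ε i : ℂ) • Φ i :=
    DFunLike.congr_fun (comp_jointSystemOp_systemHamiltonian ε i) Φ
  rw [ContinuousLinearMap.comp_apply, ContinuousLinearMap.comp_apply, h, shiftOp_apply,
    shiftOp_apply, h, map_smul]

theorem jointSystemOp_comp (A B : Matrix ι ι ℂ) :
    jointSystemOp A ∘L jointSystemOp B = jointSystemOp (A * B) := by
  rw [jointSystemOp, jointSystemOp, tensorOp_comp, ContinuousLinearMap.id_comp, jointSystemOp]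

theorem workUnitary_comp (ε : ι → ℝ) (A B : Matrix ι ι ℂ) :
    workUnitary ε A ∘L workUnitary ε B = workUnitary ε (A * B) := by
  simp only [workUnitary, ContinuousLinearMap.comp_assoc]
  rw [← ContinuousLinearMap.comp_assoc (shiftOp ε), shiftOp_comp_adjoint,
    ContinuousLinearMap.id_comp, ← ContinuousLinearMap.comp_assoc (jointSystemOp A),
    jointSystemOp_comp]

theorem workUnitary_one (ε : ι → ℝ) : workUnitary ε 1 = .id ℂ (Joint ι) := by
  rw [workUnitary, jointSystemOp, tensorOp_one_id, ContinuousLinearMap.id_comp,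
    adjoint_shiftOp_comp]

theorem adjoint_workUnitary (ε : ι → ℝ) (A : Matrix ι ι ℂ) :
    adjoint (workUnitary ε A) = workUnitary ε A.conjTranspose := by
  simp only [workUnitary, ContinuousLinearMap.adjoint_comp, ContinuousLinearMap.adjoint_adjoint,
    jointSystemOp, adjoint_tensorOp, ContinuousLinearMap.adjoint_id,
    ContinuousLinearMap.comp_assoc]

theorem jointSystemOp_comp_shiftOp (ε : ι → ℝ) (A : Matrix ι ι ℂ) :
    jointSystemOp A ∘L shiftOp ε = shiftOp ε ∘L workUnitary ε A := by
  rw [workUnitary, ← ContinuousLinearMap.comp_assoc, shiftOp_comp_adjoint,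
    ContinuousLinearMap.id_comp]

theorem workUnitary_eq_sum (ε : ι → ℝ) (A : Matrix ι ι ℂ) :
    workUnitary ε A =
      ∑ i, ∑ l, tensorOp (Matrix.single i l (A i l)) (displacement (ε l - ε i)) := by
  have h (i l : ι) : Matrix.single i i 1 * A * Matrix.single l l 1 = Matrix.single i l (A i l) := by
    rw [Matrix.single_mul_mul_single, one_mul, mul_one]
  rw [workUnitary, adjoint_shiftOp, shiftOp, shiftOp, jointSystemOp]
  simp only [ContinuousLinearMap.finsetSum_comp, ContinuousLinearMap.comp_finsetSum,
    tensorOp_comp, ContinuousLinearMap.id_comp, displacement_comp, ← mul_assoc, h, Pi.neg_apply,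
    neg_add_eq_sub]
  exact Finset.sum_comm

theorem comp_workUnitary (ε : ι → ℝ) (A : Matrix ι ι ℂ) (i : ι) :
    comp i ∘L workUnitary ε A = ∑ l, A i l • (displacement (ε l - ε i) ∘L comp l) := by
  rw [workUnitary, ← ContinuousLinearMap.comp_assoc, adjoint_shiftOp, comp_shiftOp,
    ContinuousLinearMap.comp_assoc, ← ContinuousLinearMap.comp_assoc (comp i), jointSystemOp,
    comp_comp_tensorOp]
  simp only [ContinuousLinearMap.finsetSum_comp, ContinuousLinearMap.comp_finsetSum,
    ContinuousLinearMap.smul_comp, ContinuousLinearMap.comp_smul, ContinuousLinearMap.id_comp,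
    comp_shiftOp, ← ContinuousLinearMap.comp_assoc, displacement_comp, Pi.neg_apply,
    neg_add_eq_sub]

theorem hsInner_tensorOp_workUnitary_comp (ε : ι → ℝ) (A s t : Matrix ι ι ℂ)
    {X Z : Weight →L[ℂ] Weight} (hX : IsHilbertSchmidt X) (hZ : IsHilbertSchmidt Z) :
    hsInner (tensorOp s X) (workUnitary ε A ∘L tensorOp t Z) =
      ∑ i, ∑ l, A i l * (t * s.conjTranspose) l i *
        hsInner X (displacement (ε l - ε i) ∘L Z) := by
  have hterm (i l : ι) : IsHilbertSchmidt
      (tensorOp (Matrix.single i l (A i l) * t) (displacement (ε l - ε i) ∘L Z)) :=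
    (hZ.comp_left _).tensorOp _
  have htrace (i l : ι) : (s.conjTranspose * (Matrix.single i l (A i l) * t)).trace =
      A i l * (t * s.conjTranspose) l i := by
    rw [Matrix.trace_mul_comm, mul_assoc, Matrix.trace_single_mul]
    rfl
  simp only [workUnitary_eq_sum, ContinuousLinearMap.finsetSum_comp, tensorOp_comp]
  rw [hsInner_sum_right _ (hX.tensorOp s) fun i => .sum fun l _ => hterm i l]
  simp only [hsInner_sum_right _ (hX.tensorOp s) (hterm _),
    hsInner_tensorOp _ _ hX (hZ.comp_left _), htrace]

section IsComp

variable {H : Type*} [NormedAddCommGroup H] [InnerProductSpace ℂ H] {X Z : H →L[ℂ] Joint ι}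

theorem IsComp.shiftOp_comp (h : IsComp jointWeightHamiltonian X Z) (ε : ι → ℝ) :
    IsComp jointWeightHamiltonian (shiftOp ε ∘L X)
      (shiftOp ε ∘L (Z + jointSystemOp (systemHamiltonian ε) ∘L X)) := by
  refine isComp_jointWeightHamiltonian_iff.2 fun i => ?_
  have hi := (isComp_jointWeightHamiltonian_iff.1 h i).displacement_comp (ε i)
  rwa [← ContinuousLinearMap.comp_assoc, ← ContinuousLinearMap.comp_assoc, comp_shiftOp,
    ContinuousLinearMap.comp_assoc, ContinuousLinearMap.comp_assoc, ContinuousLinearMap.comp_add,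
    ← ContinuousLinearMap.comp_assoc (comp i) (jointSystemOp _),
    comp_jointSystemOp_systemHamiltonian, ContinuousLinearMap.smul_comp]

theorem IsComp.energyDifference_shiftOp_comp (h : IsComp jointWeightHamiltonian X Z) (ε : ι → ℝ) :
    IsComp (ofBounded (jointSystemOp (systemHamiltonian ε)) - jointWeightHamiltonian)
      (shiftOp ε ∘L X) (-(shiftOp ε ∘L Z)) := by
  have hS := (isComp_ofBounded (jointSystemOp (systemHamiltonian ε)) (shiftOp ε ∘L X)).sub
    (h.shiftOp_comp ε)
  rwa [← ContinuousLinearMap.comp_assoc, jointSystemOp_systemHamiltonian_comp_shiftOp,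
    ContinuousLinearMap.comp_assoc, ContinuousLinearMap.comp_add, sub_add_cancel_right] at hS

theorem IsComp.workUnitary_comp (h : IsComp jointWeightHamiltonian X Z) (ε : ι → ℝ)
    (A : Matrix ι ι ℂ) :
    IsComp jointWeightHamiltonian (workUnitary ε A ∘L X) (workUnitary ε A ∘L Z +
      workUnitary ε (A * systemHamiltonian ε - systemHamiltonian ε * A) ∘L X) := by
  refine isComp_jointWeightHamiltonian_iff.2 fun i => ?_
  have hi := IsComp.sum (s := Finset.univ) fun l =>
    ((isComp_jointWeightHamiltonian_iff.1 h l).displacement_comp (ε l - ε i)).smul (A i l)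
  convert hi using 1
  · rw [← ContinuousLinearMap.comp_assoc, comp_workUnitary]
    simp only [ContinuousLinearMap.finsetSum_comp, ContinuousLinearMap.smul_comp,
      ContinuousLinearMap.comp_assoc]
  · rw [ContinuousLinearMap.comp_add, ← ContinuousLinearMap.comp_assoc,
      ← ContinuousLinearMap.comp_assoc, comp_workUnitary, comp_workUnitary]
    simp only [ContinuousLinearMap.finsetSum_comp, ContinuousLinearMap.smul_comp,
      ContinuousLinearMap.comp_assoc, ContinuousLinearMap.comp_add, ContinuousLinearMap.comp_smul,
      smul_add, smul_smul, ← Finset.sum_add_distrib, systemHamiltonian, Matrix.sub_apply,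
      Matrix.mul_diagonal, Matrix.diagonal_mul]
    push_cast
    exact Finset.sum_congr rfl fun l _ => by congr 2; ring

theorem IsComp.conjBy_workUnitary (h : IsComp jointWeightHamiltonian X Z) (ε : ι → ℝ)
    {V : Matrix ι ι ℂ} (hV : V ∈ Matrix.unitaryGroup ι ℂ) :
    IsComp (QuantumWeight.conjBy (workUnitary ε V) jointWeightHamiltonian) X
      (Z + workUnitary ε (workOperator ε V) ∘L X) := by
  have hVV : V.conjTranspose * V = 1 := Matrix.mem_unitaryGroup_iff'.1 hV
  have hU := (h.workUnitary_comp ε V).conjBy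
  rwa [ContinuousLinearMap.comp_add, ← ContinuousLinearMap.comp_assoc,
    ← ContinuousLinearMap.comp_assoc, adjoint_workUnitary, QuantumWeight.workUnitary_comp,
    QuantumWeight.workUnitary_comp, hVV, workUnitary_one, ContinuousLinearMap.id_comp, mul_sub,
    ← mul_assoc, ← mul_assoc, hVV, one_mul] at hU

end IsComp

end WorkUnitary

section CharacteristicFunction

open ContinuousLinearMap (adjoint)

/-- The characteristic function `Tr[e^{i H_W s} e^{-i Δ_W ω} ρ]` of a weight state in its energy
and time variables. -/
def charFn (ρ : Weight →L[ℂ] Weight) (ω s : ℝ) : ℂ :=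
  trace ((expWeightHamiltonian s ∘L displacement ω) ∘L ρ)

theorem expWeightHamiltonian_zero :
    expWeightHamiltonian 0 = ContinuousLinearMap.id ℂ Weight := by
  ext1 ψ
  apply Lp.ext
  filter_upwards [expWeightHamiltonian_apply_ae 0 ψ] with x hx
  rw [hx, ofReal_zero, mul_zero, Complex.exp_zero, one_mul, ContinuousLinearMap.id_apply]

variable {ρ Y : Weight →L[ℂ] Weight}

theorem xiDenominator_eq_charFn (s : ℝ) : xiDenominator ρ s = charFn ρ 0 s := by
  rw [xiDenominator, charFn, displacement_zero, ContinuousLinearMap.comp_id]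

theorem charFn_zero_right (hρ : IsDensityOperator ρ) (ω : ℝ) :
    charFn ρ ω 0 = hsInner (sqrtOp ρ) (displacement ω ∘L sqrtOp ρ) := by
  rw [charFn, hρ.trace_comp_self, expWeightHamiltonian_zero, ContinuousLinearMap.id_comp]

theorem charFn_zero_zero (hρ : IsDensityOperator ρ) : charFn ρ 0 0 = 1 := by
  rw [charFn_zero_right hρ, displacement_zero, ContinuousLinearMap.id_comp,
    hρ.hsInner_sqrtOp_self]

theorem charFn_eq_integral (hρ : IsDensityOperator ρ) (ω s : ℝ) :
    charFn ρ ω s = ∫ x : ℝ, cexp (I * x * s) *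
      ⟪wave hρ.isHilbertSchmidt_sqrtOp x, wave hρ.isHilbertSchmidt_sqrtOp (x - ω)⟫_ℂ := by
  have hT := hρ.isHilbertSchmidt_sqrtOp
  rw [charFn, hρ.trace_comp_self, ContinuousLinearMap.comp_assoc,
    ← inner_wave hT ((hT.comp_left _).comp_left _), L2.inner_def]
  refine integral_congr_ae ?_
  filter_upwards [wave_exp_ae (hT.comp_left (displacement ω)) s, wave_displacement_ae hT ω]
    with x hexp hdisplacement
  rw [hexp, hdisplacement, inner_smul_right]

theorem hasDerivAt_integral_exp_smul {E : Type*} [NormedAddCommGroup E] [NormedSpace ℂ E]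
    {G : ℝ → E} (hG : Integrable G) (hG' : Integrable fun x : ℝ => (x : ℂ) • G x) (s : ℝ) :
    HasDerivAt (fun s : ℝ => ∫ x : ℝ, cexp (I * x * s) • G x)
      (∫ x : ℝ, cexp (I * x * s) • I • (x : ℂ) • G x) s := by
  have hnorm (x s : ℝ) : ‖cexp (I * x * s)‖ = 1 := norm_cexp_I_mul x s
  have hmeas (s : ℝ) : AEStronglyMeasurable (fun x : ℝ => cexp (I * x * s)) := by fun_prop
  have hphase (x s : ℝ) :
      HasDerivAt (fun s : ℝ => cexp (I * x * s)) (cexp (I * x * s) * (I * x)) s := by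
    simpa only [ofRealCLM_apply, ofReal_one, mul_one] using
      ((ofRealCLM.hasDerivAt (x := s)).const_mul (I * (x : ℂ))).cexp
  refine (hasDerivAt_integral_of_dominated_loc_of_deriv_le
    (F := fun s x : ℝ => cexp (I * x * s) • G x)
    (F' := fun s x : ℝ => cexp (I * x * s) • I • (x : ℂ) • G x)
    (bound := fun x : ℝ => ‖(x : ℂ) • G x‖)
    Filter.univ_mem (.of_forall fun s => (hmeas s).smul hG.1)
    (hG.bdd_smul 1 (hmeas s) (.of_forall fun x => (hnorm x s).le))
    ((hmeas s).smul (hG'.1.const_smul I))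
    (.of_forall fun x s _ => ?_) hG'.norm (.of_forall fun x s _ => ?_)).2
  · rw [norm_smul, hnorm, one_mul, norm_smul, norm_I, one_mul]
  · simpa only [smul_smul, mul_assoc] using (hphase x s).smul_const (G x)

theorem hasDerivAt_charFn (hρ : IsDensityOperator ρ) (hY : IsHilbertSchmidt Y)
    (h : IsComp weightHamiltonian (sqrtOp ρ) Y) (ω : ℝ) :
    HasDerivAt (charFn ρ ω) (I * hsInner Y (displacement ω ∘L sqrtOp ρ)) 0 := by
  have hT := hρ.isHilbertSchmidt_sqrtOp
  set Φ := wave hT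
  set Φω := wave (hT.comp_left (displacement ω))
  have hmul : (fun x => ⟪wave hY x, Φω x⟫_ℂ) =ᵐ[volume] fun x => (x : ℂ) • ⟪Φ x, Φω x⟫_ℂ := by
    filter_upwards [wave_weightHamiltonian_ae hT hY h] with x hx
    rw [hx, inner_smul_left, conj_ofReal, smul_eq_mul]
  have hchar : charFn ρ ω = fun s : ℝ => ∫ x : ℝ, cexp (I * x * s) • ⟪Φ x, Φω x⟫_ℂ := by
    ext s
    rw [charFn_eq_integral hρ]
    refine integral_congr_ae ?_
    filter_upwards [wave_displacement_ae hT ω] with x hx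
    rw [hx, smul_eq_mul]
  rw [hchar, ← inner_wave hY (hT.comp_left _), L2.inner_def, integral_congr_ae hmul,
    ← smul_eq_mul I, ← integral_smul]
  simpa only [ofReal_zero, mul_zero, Complex.exp_zero, one_smul] using
    hasDerivAt_integral_exp_smul (L2.integrable_inner Φ Φω)
      ((L2.integrable_inner (𝕜 := ℂ) (wave hY) Φω).congr hmul) 0

variable {ι : Type*} [Fintype ι] [DecidableEq ι] {ε : ι → ℝ} {ρS : Matrix ι ι ℂ}

theorem freeEvolution_apply (t : ℝ) (i j : ι) :
    freeEvolution ε ρS t i j = cexp (-(I * t * (ε i - ε j : ℝ))) * ρS i j := by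
  rw [freeEvolution, systemHamiltonian, ← Matrix.diagonal_smul, ← Matrix.diagonal_smul,
    Matrix.exp_diagonal, Matrix.exp_diagonal, Matrix.mul_diagonal, Matrix.diagonal_mul,
    Pi.coe_exp, Pi.coe_exp]
  simp only [Pi.smul_apply, smul_eq_mul, ← Complex.exp_eq_exp_ℂ]
  rw [mul_right_comm, ← Complex.exp_add]
  congr 2
  push_cast
  ring

theorem xi_apply (hρ : IsDensityOperator ρ) (hE : HasFiniteSecondMoment weightHamiltonian ρ)
    (s : ℝ) (i j : ι) :
    xi ε ρS ρ s i j = ρS i j *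
      (cexp (-(I * (ε i - ε j : ℝ) * s / 2)) * charFn ρ (ε i - ε j) s) / charFn ρ 0 s := by
  have hT := hρ.isHilbertSchmidt_sqrtOp
  obtain ⟨Y, hY, hTY⟩ :=
    exists_isHilbertSchmidt_isComp isClosed_weightHamiltonian hE.mem_domain hE.summable
  have hΦ := integrable_wave hT hY hTY
  have hpi : (Real.pi : ℂ) ≠ 0 := ofReal_ne_zero.2 Real.pi_ne_zero
  rw [xi, Matrix.of_apply, xiDenominator_eq_charFn]
  congr 1
  calc ∫ t : ℝ, (∫ E : ℝ, cexp (I * E * s) * wigner ρ E t) * freeEvolution ε ρS t i j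
      = ∫ t : ℝ, ρS i j / (2 * Real.pi) *
          (⟪timeAmplitude (wave hT) (t + s / 2), timeAmplitude (wave hT) (t - s / 2)⟫_ℂ *
            cexp (-(I * t * (ε i - ε j : ℝ)))) := by
        refine integral_congr_ae <| .of_forall fun t => ?_
        beta_reduce
        rw [integral_exp_mul_wigner hΦ hρ.kernel_ae_eq, freeEvolution_apply]
        ring
    _ = _ := by
        rw [integral_const_mul, integral_inner_timeAmplitude_shifted hΦ (Lp.memLp _),
          ← charFn_eq_integral hρ]
        field_simp

theorem controlMarginal_apply (hρ : IsDensityOperator ρ) (i j : ι) :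
    controlMarginal ε ρS ρ i j = ρS i j * charFn ρ (ε i - ε j) 0 := by
  have hT := hρ.isHilbertSchmidt_sqrtOp
  set T := sqrtOp ρ with hTdef
  have hincl : adjoint (shiftOp ε) ∘L incl j = incl j ∘L adjoint (displacement (ε j)) := by
    rw [← adjoint_comp, ← ContinuousLinearMap.adjoint_comp, comp_shiftOp,
      ContinuousLinearMap.adjoint_comp]
  have hentry : comp i ∘L controlState ε ρS ρ ∘L incl j =
      ρS i j • ((displacement (ε i) ∘L T) ∘L adjoint (displacement (ε j) ∘L T)) := by
    calc comp i ∘L controlState ε ρS ρ ∘L incl j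
        = (comp i ∘L shiftOp ε) ∘L tensorOp ρS ρ ∘L (adjoint (shiftOp ε) ∘L incl j) := by
          simp only [controlState, ContinuousLinearMap.comp_assoc]
      _ = displacement (ε i) ∘L (comp i ∘L tensorOp ρS ρ ∘L incl j) ∘L
          adjoint (displacement (ε j)) := by
          rw [hincl, comp_shiftOp]
          simp only [ContinuousLinearMap.comp_assoc]
      _ = _ := by
          rw [comp_tensorOp_incl, ContinuousLinearMap.smul_comp, ContinuousLinearMap.comp_smul,
            ContinuousLinearMap.adjoint_comp, hTdef, adjoint_sqrtOp]
          conv_lhs => rw [← sqrtOp_comp_self hρ.isPositive]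
          simp only [ContinuousLinearMap.comp_assoc]
  calc controlMarginal ε ρS ρ i j
      = ρS i j * trace ((displacement (ε i) ∘L T) ∘L adjoint (displacement (ε j) ∘L T)) := by
        rw [controlMarginal, partialTraceW, Matrix.of_apply, hentry]
        simp only [trace, smul_apply, inner_smul_right, tsum_mul_left]
    _ = ρS i j * hsInner (displacement (ε j) ∘L T) (displacement (ε i) ∘L T) := by
        rw [trace_comp, hsInner_adjoint (hT.comp_left _) (hT.comp_left _)]
    _ = ρS i j * charFn ρ (ε i - ε j) 0 := by
        rw [charFn_zero_right hρ, hsInner_comp_left, adjoint_displacement,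
          ← ContinuousLinearMap.comp_assoc, displacement_comp, neg_add_eq_sub]

theorem isSemiclassical_iff (hρ : IsDensityOperator ρ)
    (hE : HasFiniteSecondMoment weightHamiltonian ρ) :
    IsSemiclassical ε ρS ρ ↔ ∀ s, charFn ρ 0 s ≠ 0 → ∀ i j,
      ρS i j * charFn ρ (ε i - ε j) s =
        ρS i j * charFn ρ (ε i - ε j) 0 * (cexp (I * (ε i - ε j : ℝ) * s / 2) * charFn ρ 0 s) := by
  refine forall_congr' fun s => ?_
  rw [xiDenominator_eq_charFn]
  refine forall_congr' fun hs => ?_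
  rw [← Matrix.ext_iff]
  refine forall₂_congr fun i j => ?_
  have hexp := Complex.exp_ne_zero (I * (ε i - ε j : ℝ) * s / 2)
  rw [xi_apply hρ hE, controlMarginal_apply hρ, Complex.exp_neg, div_eq_iff hs]
  field_simp

theorem IsSemiclassical.mul_hsInner_displacement (hsc : IsSemiclassical ε ρS ρ)
    (hρ : IsDensityOperator ρ) (hE : HasFiniteSecondMoment weightHamiltonian ρ)
    (hY : IsHilbertSchmidt Y) (h : IsComp weightHamiltonian (sqrtOp ρ) Y) (i j : ι) :
    ρS i j * hsInner Y (displacement (ε i - ε j) ∘L sqrtOp ρ) =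
      controlMarginal ε ρS ρ i j * (hsInner Y (sqrtOp ρ) + (ε i - ε j) / 2) := by
  set ω := ε i - ε j with hω
  have hderiv := hasDerivAt_charFn hρ hY h 0
  rw [displacement_zero, ContinuousLinearMap.id_comp] at hderiv
  have hne : ∀ᶠ s in nhds 0, charFn ρ 0 s ≠ 0 :=
    hderiv.continuousAt.eventually_ne (charFn_zero_zero hρ ▸ one_ne_zero)
  have heq : (fun s => ρS i j * charFn ρ ω s) =ᶠ[nhds 0] fun s : ℝ =>
      ρS i j * charFn ρ ω 0 * (cexp (I * ω * s / 2) * charFn ρ 0 s) := by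
    filter_upwards [hne] with s hs using (isSemiclassical_iff hρ hE).1 hsc s hs i j
  have hphase : HasDerivAt (fun s : ℝ => cexp (I * ω * s / 2)) (I * ω / 2) 0 := by
    simpa using (((ofRealCLM.hasDerivAt (x := 0)).const_mul (I * (ω : ℂ))).div_const 2).cexp
  have hunique := ((hasDerivAt_charFn hρ hY h ω).const_mul (ρS i j)).unique
    (((hphase.mul hderiv).const_mul (ρS i j * charFn ρ ω 0)).congr_of_eventuallyEq heq)
  rw [controlMarginal_apply hρ, ← hω]
  apply mul_left_cancel₀ I_ne_zero
  simp only [charFn_zero_zero hρ, ofReal_zero, mul_zero, zero_div, Complex.exp_zero] at hunique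
  rw [hω, ofReal_sub] at hunique
  linear_combination hunique

end CharacteristicFunction

section SemiclassicalStates

variable {ι : Type*} [Fintype ι] [DecidableEq ι] {ε : ι → ℝ} {ρS : Matrix ι ι ℂ}
  {ρ : Weight →L[ℂ] Weight}

theorem isSemiclassical_of_commute (hρ : IsDensityOperator ρ)
    (hE : HasFiniteSecondMoment weightHamiltonian ρ)
    (h : Commute ρS (systemHamiltonian ε)) : IsSemiclassical ε ρS ρ := by
  refine (isSemiclassical_iff hρ hE).2 fun s _ i j => ?_
  have hij := congrFun (congrFun h.eq i) j
  rw [systemHamiltonian, Matrix.mul_diagonal, Matrix.diagonal_mul, mul_comm,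
    mul_eq_mul_right_iff, ofReal_inj] at hij
  rcases hij with hε | hzero
  · rw [hε, sub_self, charFn_zero_zero hρ]
    simp
  · rw [hzero, zero_mul, zero_mul, zero_mul]

theorem trace_comp_rankOne (A : Weight →L[ℂ] Weight) (ψ : Weight) :
    trace (A ∘L InnerProductSpace.rankOne ℂ ψ ψ) = ⟪ψ, A ψ⟫_ℂ := by
  rw [← (onb Weight).tsum_inner_mul_inner ψ (A ψ)]
  refine tsum_congr fun k => ?_
  rw [ContinuousLinearMap.comp_apply, InnerProductSpace.rankOne_apply, map_smul, inner_smul_right]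

theorem charFn_rankOne {ψ : Weight} {g : ℝ → ℂ} (hψ : ψ =ᵐ[volume] g) (ω s : ℝ) :
    charFn (InnerProductSpace.rankOne ℂ ψ ψ) ω s =
      ∫ x : ℝ, cexp (I * x * s) * (starRingEnd ℂ (g x) * g (x - ω)) := by
  rw [charFn, trace_comp_rankOne, L2.inner_def]
  refine integral_congr_ae ?_
  filter_upwards [hψ, ae_comp_sub hψ ω, expWeightHamiltonian_apply_ae s (displacement ω ψ),
    displacement_apply_ae ω ψ] with x h1 h2 h3 h4
  rw [ContinuousLinearMap.comp_apply, h3, h4, h1, h2, RCLike.inner_apply]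
  ring

theorem conj_gaussianWave_mul (μ ν ω x : ℝ) {σ : ℝ} (hσ : σ ≠ 0) :
    starRingEnd ℂ (gaussianWave μ ν σ x) * gaussianWave μ ν σ (x - ω) =
      cexp (-(I * ν * ω) - ω ^ 2 / (8 * σ ^ 2)) *
        (starRingEnd ℂ (gaussianWave μ ν σ (x - ω / 2)) * gaussianWave μ ν σ (x - ω / 2)) := by
  have hσ' : (σ : ℂ) ≠ 0 := ofReal_ne_zero.2 hσ
  simp only [gaussianWave, map_mul, conj_ofReal, ← Complex.exp_conj, map_add, map_neg,
    map_div₀, map_one, map_pow, map_sub, conj_I, map_ofNat]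
  set c : ℂ := (((2 * Real.pi * σ ^ 2) ^ (-(1 / 4 : ℝ)) : ℝ) : ℂ)
  have hmul (a b : ℂ) : c * cexp a * (c * cexp b) = c * c * cexp (a + b) := by
    rw [Complex.exp_add]
    ring
  rw [hmul, hmul, mul_left_comm, ← Complex.exp_add]
  congr 2
  push_cast
  field_simp
  ring

theorem IsGaussianPacket.exists_charFn_eq (h : IsGaussianPacket ρ) (ω : ℝ) :
    ∃ C : ℂ, ∀ s : ℝ, charFn ρ ω s = C * (cexp (I * ω * s / 2) * charFn ρ 0 s) := by
  obtain ⟨μ, ν, σ, ψ, hσ, hψ, rfl⟩ := h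
  set g := gaussianWave μ ν σ
  refine ⟨cexp (-(I * ν * ω) - ω ^ 2 / (8 * σ ^ 2)), fun s => ?_⟩
  rw [charFn_rankOne hψ, charFn_rankOne hψ, ← integral_sub_right_eq_self
    (fun x : ℝ => cexp (I * x * s) * (starRingEnd ℂ (g x) * g (x - 0))) (ω / 2),
    ← integral_const_mul, ← integral_const_mul]
  refine integral_congr_ae <| .of_forall fun x => ?_
  beta_reduce
  have hphase : cexp (I * x * s) = cexp (I * ω * s / 2) * cexp (I * (x - ω / 2 : ℝ) * s) := by
    rw [← Complex.exp_add]
    congr 1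
    push_cast
    ring
  rw [conj_gaussianWave_mul μ ν ω x hσ.ne', sub_zero, hphase]
  ring

theorem isSemiclassical_of_isGaussianPacket (hρ : IsDensityOperator ρ)
    (hE : HasFiniteSecondMoment weightHamiltonian ρ) (h : IsGaussianPacket ρ) :
    IsSemiclassical ε ρS ρ := by
  refine (isSemiclassical_iff hρ hE).2 fun s _ i j => ?_
  obtain ⟨C, hC⟩ := h.exists_charFn_eq (ε i - ε j)
  rw [hC s, hC 0, charFn_zero_zero hρ]
  simp only [ofReal_zero, mul_zero, zero_div, Complex.exp_zero, mul_one, mul_assoc]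

end SemiclassicalStates

section SystemOperators

variable {ι : Type*}

theorem isHermitian_systemHamiltonian [DecidableEq ι] (ε : ι → ℝ) :
    (systemHamiltonian ε).IsHermitian :=
  Matrix.isHermitian_diagonal_of_self_adjoint _ <| funext fun i => Complex.conj_ofReal (ε i)

variable [Fintype ι]

theorem systemMean_eq_sum (ρ A : Matrix ι ι ℂ) :
    systemMean ρ A = ∑ i, ∑ l, A i l * ρ l i := rfl

theorem systemMean_add (ρ A B : Matrix ι ι ℂ) :
    systemMean ρ (A + B) = systemMean ρ A + systemMean ρ B := by
  rw [systemMean, add_mul, Matrix.trace_add, systemMean, systemMean]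

theorem systemMean_sub (ρ A B : Matrix ι ι ℂ) :
    systemMean ρ (A - B) = systemMean ρ A - systemMean ρ B := by
  rw [systemMean, sub_mul, Matrix.trace_sub, systemMean, systemMean]

variable [DecidableEq ι] (ε : ι → ℝ) (V : Matrix ι ι ℂ)

theorem isHermitian_rotatedHamiltonian : (rotatedHamiltonian ε V).IsHermitian :=
  Matrix.isHermitian_conjTranspose_mul_mul V (isHermitian_systemHamiltonian ε)

theorem isHermitian_workOperator : (workOperator ε V).IsHermitian :=
  (isHermitian_systemHamiltonian ε).sub (isHermitian_rotatedHamiltonian ε V)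

end SystemOperators

section Moments

open ContinuousLinearMap (adjoint)

variable {ι : Type*} [Fintype ι] [DecidableEq ι] (ε : ι → ℝ) {s A B : Matrix ι ι ℂ}
  {ρ Y : Weight →L[ℂ] Weight}

theorem hsInner_sqrt_workUnitary_comp (hρ : IsDensityOperator ρ) (hs : s.IsHermitian)
    (A : Matrix ι ι ℂ) :
    hsInner (tensorOp s (sqrtOp ρ)) (workUnitary ε A ∘L tensorOp s (sqrtOp ρ)) =
      systemMean (controlMarginal ε (s * s) ρ) A := by
  rw [hsInner_tensorOp_workUnitary_comp ε A s s hρ.isHilbertSchmidt_sqrtOp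
    hρ.isHilbertSchmidt_sqrtOp, hs.eq]
  simp only [systemMean_eq_sum, controlMarginal_apply hρ, charFn_zero_right hρ, mul_assoc]

theorem hsInner_workUnitary_comp_workUnitary_comp (hρ : IsDensityOperator ρ) (hs : s.IsHermitian)
    (A B : Matrix ι ι ℂ) :
    hsInner (workUnitary ε A ∘L tensorOp s (sqrtOp ρ)) (workUnitary ε B ∘L tensorOp s (sqrtOp ρ)) =
      systemMean (controlMarginal ε (s * s) ρ) (A.conjTranspose * B) := by
  rw [hsInner_comp_left, adjoint_workUnitary, ← ContinuousLinearMap.comp_assoc, workUnitary_comp,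
    hsInner_sqrt_workUnitary_comp ε hρ hs]

theorem conj_systemMean_controlMarginal (hρ : IsDensityOperator ρ) (hs : s.IsHermitian)
    (A : Matrix ι ι ℂ) :
    starRingEnd ℂ (systemMean (controlMarginal ε (s * s) ρ) A) =
      systemMean (controlMarginal ε (s * s) ρ) A.conjTranspose := by
  rw [← hsInner_sqrt_workUnitary_comp ε hρ hs, ← hsInner_sqrt_workUnitary_comp ε hρ hs,
    hsInner_conj_symm, hsInner_comp_left, adjoint_workUnitary]

theorem ofReal_re_systemMean_controlMarginal (hρ : IsDensityOperator ρ) (hs : s.IsHermitian)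
    (hA : A.IsHermitian) :
    ((systemMean (controlMarginal ε (s * s) ρ) A).re : ℂ) =
      systemMean (controlMarginal ε (s * s) ρ) A :=
  Complex.conj_eq_iff_re.1 <| by rw [conj_systemMean_controlMarginal ε hρ hs, hA.eq]

theorem conj_systemMean_mul_controlMarginal (hρ : IsDensityOperator ρ) (hs : s.IsHermitian)
    (hA : A.IsHermitian) (hB : B.IsHermitian) :
    starRingEnd ℂ (systemMean (controlMarginal ε (s * s) ρ) (A * B)) =
      systemMean (controlMarginal ε (s * s) ρ) (B * A) := by
  rw [conj_systemMean_controlMarginal ε hρ hs, Matrix.conjTranspose_mul, hA.eq, hB.eq]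

theorem re_systemMean_commutator_eq_zero (hρ : IsDensityOperator ρ) (hs : s.IsHermitian)
    (hA : A.IsHermitian) (hB : B.IsHermitian) :
    (systemMean (controlMarginal ε (s * s) ρ) (A * B - B * A)).re = 0 := by
  rw [systemMean_sub, ← conj_systemMean_mul_controlMarginal ε hρ hs hA hB, Complex.sub_re,
    Complex.conj_re, sub_self]

theorem ofReal_hsCov_workUnitary_comp (hρ : IsDensityOperator ρ) (hs : s.IsHermitian)
    (hA : A.IsHermitian) (hB : B.IsHermitian) :
    (hsCov (tensorOp s (sqrtOp ρ)) (workUnitary ε A ∘L tensorOp s (sqrtOp ρ))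
      (workUnitary ε B ∘L tensorOp s (sqrtOp ρ)) : ℂ) =
      systemCov (controlMarginal ε (s * s) ρ) A B := by
  have hre : ((systemMean (controlMarginal ε (s * s) ρ) (A * B)).re : ℂ) =
      1 / 2 * systemMean (controlMarginal ε (s * s) ρ) (A * B + B * A) := by
    rw [systemMean_add, ← conj_systemMean_mul_controlMarginal ε hρ hs hA hB,
      Complex.re_eq_add_conj]
    ring
  rw [hsCov, hsInner_workUnitary_comp_workUnitary_comp ε hρ hs,
    hsInner_sqrt_workUnitary_comp ε hρ hs, hsInner_sqrt_workUnitary_comp ε hρ hs, hA.eq, systemCov,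
    Complex.ofReal_sub, Complex.ofReal_mul, hre, ofReal_re_systemMean_controlMarginal ε hρ hs hA,
    ofReal_re_systemMean_controlMarginal ε hρ hs hB]

variable {ε}

theorem IsSemiclassical.hsInner_workUnitary_comp (hsc : IsSemiclassical ε (s * s) ρ)
    (hρ : IsDensityOperator ρ) (hE : HasFiniteSecondMoment weightHamiltonian ρ)
    (hs : s.IsHermitian) (hY : IsHilbertSchmidt Y) (h : IsComp weightHamiltonian (sqrtOp ρ) Y)
    (A : Matrix ι ι ℂ) :
    hsInner (tensorOp s Y) (workUnitary ε A ∘L tensorOp s (sqrtOp ρ)) =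
      systemMean (controlMarginal ε (s * s) ρ) A * hsInner Y (sqrtOp ρ) +
        systemMean (controlMarginal ε (s * s) ρ)
          (A * systemHamiltonian ε - systemHamiltonian ε * A) / 2 := by
  rw [hsInner_tensorOp_workUnitary_comp ε A s s hY hρ.isHilbertSchmidt_sqrtOp, hs.eq]
  simp only [mul_assoc, hsc.mul_hsInner_displacement hρ hE hY h]
  simp only [systemMean_eq_sum, systemHamiltonian, Matrix.sub_apply, Matrix.mul_diagonal,
    Matrix.diagonal_mul, Finset.sum_mul, Finset.sum_div, ← Finset.sum_add_distrib]
  exact Finset.sum_congr rfl fun i _ => Finset.sum_congr rfl fun l _ => by ring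

theorem hsInner_tensorOp_of_trace_eq_one (hs : s.IsHermitian) (h1 : (s * s).trace = 1)
    {X Y : Weight →L[ℂ] Weight} (hX : IsHilbertSchmidt X) (hY : IsHilbertSchmidt Y) :
    hsInner (tensorOp s X) (tensorOp s Y) = hsInner X Y := by
  rw [hsInner_tensorOp s s hX hY, hs.eq, h1, one_mul]

theorem IsSemiclassical.hsCov_workUnitary_comp_eq_zero (hsc : IsSemiclassical ε (s * s) ρ)
    (hρ : IsDensityOperator ρ) (hE : HasFiniteSecondMoment weightHamiltonian ρ)
    (hs : s.IsHermitian) (h1 : (s * s).trace = 1) (hY : IsHilbertSchmidt Y)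
    (h : IsComp weightHamiltonian (sqrtOp ρ) Y) (hA : A.IsHermitian) :
    hsCov (tensorOp s (sqrtOp ρ)) (tensorOp s Y)
      (workUnitary ε A ∘L tensorOp s (sqrtOp ρ)) = 0 := by
  have hcomm := re_systemMean_commutator_eq_zero ε hρ hs hA (isHermitian_systemHamiltonian ε)
  rw [hsCov, hsc.hsInner_workUnitary_comp hρ hE hs hY h, hsInner_sqrt_workUnitary_comp ε hρ hs,
    hsInner_tensorOp_of_trace_eq_one hs h1 hρ.isHilbertSchmidt_sqrtOp hY,
    hsInner_re_comm (sqrtOp ρ) Y, ← ofReal_re_systemMean_controlMarginal ε hρ hs hA,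
    Complex.add_re, Complex.re_ofReal_mul, Complex.ofReal_re, Complex.div_ofNat_re, hcomm]
  ring

end Moments

section ProductState

open ContinuousLinearMap (adjoint)

variable {ι : Type*} [Fintype ι] [DecidableEq ι] (ε : ι → ℝ) {V s : Matrix ι ι ℂ}
  {ρ Y : Weight →L[ℂ] Weight}

theorem sqrtOp_controlState (hs : s.PosSemidef) (hρ : ρ.IsPositive) :
    sqrtOp (controlState ε (s * s) ρ) =
      shiftOp ε ∘L tensorOp s (sqrtOp ρ) ∘L adjoint (shiftOp ε) := by
  refine sqrtOp_eq_of_comp_self ?_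
    ((isPositive_tensorOp hs (isPositive_sqrtOp ρ)).conj_adjoint (shiftOp ε))
  simp only [controlState, ContinuousLinearMap.comp_assoc]
  rw [← ContinuousLinearMap.comp_assoc (adjoint (shiftOp ε)), adjoint_shiftOp_comp,
    ContinuousLinearMap.id_comp, ← ContinuousLinearMap.comp_assoc (tensorOp s (sqrtOp ρ)),
    tensorOp_comp, sqrtOp_comp_self hρ]

theorem isComp_sqrtOp_tensorOp (hs : s.PosSemidef) (hρ : ρ.IsPositive)
    (h : IsComp weightHamiltonian (sqrtOp ρ) Y) :
    IsComp jointWeightHamiltonian (sqrtOp (tensorOp (s * s) ρ)) (tensorOp s Y) := by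
  simpa only [sqrtOp_tensorOp hs hρ] using h.tensorOp s

theorem hasFiniteSecondMoment_tensorOp (hs : s.PosSemidef) (hρ : ρ.IsPositive)
    (hY : IsHilbertSchmidt Y) (h : IsComp weightHamiltonian (sqrtOp ρ) Y) :
    HasFiniteSecondMoment jointWeightHamiltonian (tensorOp (s * s) ρ) :=
  (isComp_sqrtOp_tensorOp hs hρ h).hasFiniteSecondMoment (hY.tensorOp s)

theorem hasFiniteSecondMoment_conjBy_workUnitary (hV : V ∈ Matrix.unitaryGroup ι ℂ)
    (hs : s.PosSemidef) (hρ : IsDensityOperator ρ) (hY : IsHilbertSchmidt Y)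
    (h : IsComp weightHamiltonian (sqrtOp ρ) Y) :
    HasFiniteSecondMoment (conjBy (workUnitary ε V) jointWeightHamiltonian)
      (tensorOp (s * s) ρ) := by
  refine ((isComp_sqrtOp_tensorOp hs hρ.isPositive h).conjBy_workUnitary ε
    hV).hasFiniteSecondMoment ((hY.tensorOp s).add ?_)
  rw [sqrtOp_tensorOp hs hρ.isPositive]
  exact (hρ.isHilbertSchmidt_sqrtOp.tensorOp s).comp_left _

theorem hasFiniteSecondMoment_controlState (hs : s.PosSemidef) (hρ : IsDensityOperator ρ)
    (hY : IsHilbertSchmidt Y) (h : IsComp weightHamiltonian (sqrtOp ρ) Y) :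
    HasFiniteSecondMoment jointWeightHamiltonian (controlState ε (s * s) ρ) := by
  have hcomp := ((h.tensorOp s).shiftOp_comp ε).comp_right (adjoint (shiftOp ε))
  rw [ContinuousLinearMap.comp_assoc, ← sqrtOp_controlState ε hs hρ.isPositive] at hcomp
  exact hcomp.hasFiniteSecondMoment <| ((hY.tensorOp s).add
    ((hρ.isHilbertSchmidt_sqrtOp.tensorOp s).comp_left _)).comp_left _ |>.comp_right _

theorem varianceChange_eq_hsCov (hV : V ∈ Matrix.unitaryGroup ι ℂ) (hs : s.PosSemidef)
    (hρ : IsDensityOperator ρ) (hY : IsHilbertSchmidt Y)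
    (h : IsComp weightHamiltonian (sqrtOp ρ) Y) :
    varianceChange ε V (s * s) ρ =
      2 * hsCov (tensorOp s (sqrtOp ρ)) (tensorOp s Y)
          (workUnitary ε (workOperator ε V) ∘L tensorOp s (sqrtOp ρ)) +
        hsCov (tensorOp s (sqrtOp ρ)) (workUnitary ε (workOperator ε V) ∘L tensorOp s (sqrtOp ρ))
          (workUnitary ε (workOperator ε V) ∘L tensorOp s (sqrtOp ρ)) := by
  have hsqrt := sqrtOp_tensorOp hs hρ.isPositive
  have hT := hρ.isHilbertSchmidt_sqrtOp.tensorOp s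
  have hR : IsHilbertSchmidt (sqrtOp (tensorOp (s * s) ρ)) := hsqrt ▸ hT
  have hW := hR.comp_left (workUnitary ε (workOperator ε V))
  have hZ := hY.tensorOp s
  have hH := isComp_sqrtOp_tensorOp hs hρ.isPositive h
  have hU := hH.conjBy_workUnitary ε hV
  rw [varianceChange, var, var, cov_eq_hsCov hR (hZ.add hW) (hZ.add hW) hU hU,
    cov_eq_hsCov hR hZ hZ hH hH, hsCov_add_self hR hZ hW, hsqrt]
  ring

theorem fTerm_eq_neg_hsCov (hs : s.PosSemidef) (hρ : IsDensityOperator ρ)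
    (hY : IsHilbertSchmidt Y) (h : IsComp weightHamiltonian (sqrtOp ρ) Y) (V : Matrix ι ι ℂ) :
    fTerm ε V (s * s) ρ = -hsCov (tensorOp s (sqrtOp ρ)) (tensorOp s Y)
      (workUnitary ε (rotatedHamiltonian ε V) ∘L tensorOp s (sqrtOp ρ)) := by
  have hsqrt := sqrtOp_controlState ε hs hρ.isPositive
  have hR := hρ.isHilbertSchmidt_sqrtOp.tensorOp s
  have hZ := hY.tensorOp s
  have hW := hR.comp_left (workUnitary ε (rotatedHamiltonian ε V))
  have hconj {X : Joint ι →L[ℂ] Joint ι} (hX : IsHilbertSchmidt X) :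
      IsHilbertSchmidt (shiftOp ε ∘L X ∘L adjoint (shiftOp ε)) :=
    (hX.comp_right _).comp_left _
  have hD := ((h.tensorOp s).energyDifference_shiftOp_comp ε).comp_right (adjoint (shiftOp ε))
  rw [ContinuousLinearMap.comp_assoc, ← hsqrt, ContinuousLinearMap.neg_comp,
    ContinuousLinearMap.comp_assoc] at hD
  have hB := isComp_ofBounded (jointSystemOp (rotatedHamiltonian ε V))
    (sqrtOp (controlState ε (s * s) ρ))
  have hBS : jointSystemOp (rotatedHamiltonian ε V) ∘L sqrtOp (controlState ε (s * s) ρ) =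
      shiftOp ε ∘L (workUnitary ε (rotatedHamiltonian ε V) ∘L tensorOp s (sqrtOp ρ)) ∘L
        adjoint (shiftOp ε) := by
    rw [hsqrt, ← ContinuousLinearMap.comp_assoc, jointSystemOp_comp_shiftOp]
    simp only [ContinuousLinearMap.comp_assoc]
  rw [hBS] at hB
  rw [fTerm, cov_eq_hsCov (hsqrt ▸ hconj hR) (hconj hZ).neg (hconj hW) hD hB, hsqrt,
    hsCov_neg_left, hsCov_conj hR hZ hW (adjoint_shiftOp_comp ε)]

end ProductState

end QuantumWeight

end

theorem corollary1 {ι : Type*} [Fintype ι] [DecidableEq ι]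
    (ε : ι → ℝ) (V : Matrix ι ι ℂ) (hV : V ∈ Matrix.unitaryGroup ι ℂ)
    (ρS : Matrix ι ι ℂ) (hρS : QuantumWeight.IsDensityMatrix ρS)
    (ρW : QuantumWeight.Weight →L[ℂ] QuantumWeight.Weight)
    (hρW : QuantumWeight.IsDensityOperator ρW)
    (hE : QuantumWeight.HasFiniteSecondMoment QuantumWeight.weightHamiltonian ρW) :
    -- the means, variances and covariances below are those of well-defined second moments
    (QuantumWeight.HasFiniteSecondMoment QuantumWeight.jointWeightHamiltonian
        (QuantumWeight.tensorOp ρS ρW) ∧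
      QuantumWeight.HasFiniteSecondMoment
        (QuantumWeight.conjBy (QuantumWeight.workUnitary ε V)
          QuantumWeight.jointWeightHamiltonian)
        (QuantumWeight.tensorOp ρS ρW) ∧
      QuantumWeight.HasFiniteSecondMoment QuantumWeight.jointWeightHamiltonian
        (QuantumWeight.controlState ε ρS ρW)) ∧
    -- semi-classical states
    (QuantumWeight.IsSemiclassical ε ρS ρW →
      QuantumWeight.fTerm ε V ρS ρW = 0 ∧
      (QuantumWeight.varianceChange ε V ρS ρW : ℂ) =
        QuantumWeight.systemVar (QuantumWeight.controlMarginal ε ρS ρW)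
          (QuantumWeight.workOperator ε V) ∧
      0 ≤ QuantumWeight.varianceChange ε V ρS ρW) ∧
    -- Gaussian wave packets and incoherent system states are semi-classical
    (QuantumWeight.IsGaussianPacket ρW → QuantumWeight.IsSemiclassical ε ρS ρW) ∧
    (Commute ρS (QuantumWeight.systemHamiltonian ε) →
      QuantumWeight.IsSemiclassical ε ρS ρW) := by
  obtain ⟨s, hs, rfl⟩ := QuantumWeight.exists_posSemidef_sqrt hρS.posSemidef
  obtain ⟨Y, hY, hTY⟩ := QuantumWeight.exists_isHilbertSchmidt_isComp
    QuantumWeight.isClosed_weightHamiltonian hE.mem_domain hE.summable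
  refine ⟨⟨QuantumWeight.hasFiniteSecondMoment_tensorOp hs hρW.isPositive hY hTY,
    QuantumWeight.hasFiniteSecondMoment_conjBy_workUnitary ε hV hs hρW hY hTY,
    QuantumWeight.hasFiniteSecondMoment_controlState ε hs hρW hY hTY⟩, fun hsc => ?_,
    QuantumWeight.isSemiclassical_of_isGaussianPacket hρW hE,
    QuantumWeight.isSemiclassical_of_commute hρW hE⟩
  have hT := hρW.isHilbertSchmidt_sqrtOp
  have hW := QuantumWeight.isHermitian_workOperator ε V
  have hcov {A : Matrix ι ι ℂ} (hA : A.IsHermitian) :=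
    hsc.hsCov_workUnitary_comp_eq_zero hρW hE hs.1 hρS.trace_one hY hTY hA
  have hΔ := QuantumWeight.varianceChange_eq_hsCov ε hV hs hρW hY hTY
  rw [hcov hW, mul_zero, zero_add] at hΔ
  refine ⟨?_, ?_, ?_⟩
  · rw [QuantumWeight.fTerm_eq_neg_hsCov ε hs hρW hY hTY,
      hcov (QuantumWeight.isHermitian_rotatedHamiltonian ε V), neg_zero]
  · rw [hΔ, QuantumWeight.ofReal_hsCov_workUnitary_comp ε hρW hs.1 hW hW, QuantumWeight.systemVar]
  · exact hΔ ▸ QuantumWeight.hsCov_self_nonneg (hT.tensorOp s) ((hT.tensorOp s).comp_left _)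
      ((QuantumWeight.hsInner_tensorOp_of_trace_eq_one hs.1 hρS.trace_one hT hT).trans
        hρW.hsInner_sqrtOp_self)
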